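/- Let $k\ge 1$ and $d\ge k+1$. Write $|\cdot|$ for Lebesgue measure on $\mathbb R^d$, $Q_L=[-L/2,L/2]^d$, and let $\mu$ be the Haar probability measure on $SO(d)$. A measurable set $A\subseteq[0,1]^d$ is \emph{$(\varepsilon,L)$-uniformly distributed} if $$\int_{[0,1]^d}\left|\frac{|A\cap(t+Q_L)|}{|Q_L|}-|A|\right|^2dt\le\varepsilon^2 .$$ For linearly independent $v_1,\dots,v_k\in\mathbb R^d$ let $\Delta_k=\{0,v_1,\dots,v_k\}$ (a non-degenerate $k$-dimensional simplex) and $$c_{\Delta_k}=\min_{1\le j\le k}\operatorname{dist}\bigl(v_j,\operatorname{span}\{v_i: i\ne j\}\bigr).$$ A set contains an isometric copy of $\lambda\cdot\Delta_k$ if it contains $x+\lambda\, U(\Delta_k)$ for some $x\in\mathbb R^d$ and $U\in SO(d)$. (1) There is a constant $C>0$ depending only on $k$ and $d$, and for every $R>0$ there is an $\varepsilon_0>0$ depending only on $k$, $d$ and $R$, such that the following holds for every non-degenerate simplex $\Delta_k=\{0,v_1,\dots,v_k\}$ with $c_{\Delta_k}\le1$ and $|v_j|\le R$ for all $j$. Let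 $0<\lambda\le\varepsilon\le\varepsilon_0$ and let $A\subseteq[0,1]^d$ be measurable with $\alpha=|A|>0$. If $A$ is $(\varepsilon,\varepsilon^4\lambda)$-uniformly distributed, then $$\left|\int_{\mathbb R^d}\int_{SO(d)}1_A(x)\,1_A(x-\lambda\, U v_1)\cdots1_A(x-\lambda\, U v_k)\,d\mu(U)\,dx-\alpha^{k+1}\right|\le C\,c_{\Delta_k}^{-1/6}\varepsilon^{2/3},$$ and if moreover $C\,c_{\Delta_k}^{-1/6}\varepsilon^{2/3}<\alpha^{k+1}$, then $A$ contains an isometric copy of $\lambda\cdot\Delta_k$. (2) (Bourgain) Let $\Delta_k=\{0,v_1,\dots,v_k\}$ be a non-degenerate $k$-dimensional simplex. If a measurable set $A\subseteq\mathbb R^d$ has positive upper Banach density, $$\delta^*(A)=\lim_{N\to\infty}\sup_{t\in\mathbb R^d}\frac{|A\cap(t+Q_N)|}{|Q_N|}>0,$$ then there is a $\lambda_0=\lambda_0(A,\Delta_k)>0$ such that $A$ contains an isometric copy of $\lambda\cdot\Delta_k$ for all $\lambda\ge\lambda_0$. -/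

import Mathlib

open MeasureTheory Filter Set
open scoped ENNReal Topology

noncomputable section

namespace Simplices

/-- `ℝ^d` with its Euclidean norm and Lebesgue measure. -/
abbrev E (d : ℕ) : Type := EuclideanSpace ℝ (Fin d)

/-- The unit cube `[0,1]^d`. -/
def unitCube (d : ℕ) : Set (E d) := {x | ∀ i, 0 ≤ x i ∧ x i ≤ 1}

/-- The cube `t + Q_L`, where `Q_L = [-L/2, L/2]^d`. -/
def cube {d : ℕ} (t : E d) (L : ℝ) : Set (E d) := {x | ∀ i, |x i - t i| ≤ L / 2}

/-- The inequality defining `(ε, L)`-uniform distribution of a set `A ⊆ [0,1]^d`. -/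
def IsUniformlyDistributed {d : ℕ} (ε L : ℝ) (A : Set (E d)) : Prop :=
  A ⊆ unitCube d ∧
    ∫ t in unitCube d,
      |volume.real (A ∩ cube t L) / volume.real (cube (0 : E d) L) - volume.real A| ^ 2 ≤ ε ^ 2

/-- Upper Banach density. The limit in `N` exists for measurable sets, so that it is the
upper limit. -/
def upperBanachDensity {d : ℕ} (A : Set (E d)) : ℝ≥0∞ :=
  limsup (fun N : ℝ => ⨆ t : E d, volume (A ∩ cube t N) / volume (cube (0 : E d) N)) atTop

/-- The rotation group `SO(d)`. -/
abbrev SO (d : ℕ) : Type := Matrix.specialOrthogonalGroup (Fin d) ℝ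

instance (d : ℕ) : IsTopologicalGroup (SO d) where
  continuous_mul := by
    refine continuous_induced_rng.mpr ?_
    exact (continuous_subtype_val.comp continuous_fst).mul
      (continuous_subtype_val.comp continuous_snd)
  continuous_inv := by
    refine continuous_induced_rng.mpr ?_
    exact (continuous_subtype_val (p := fun M => M ∈ Matrix.specialOrthogonalGroup (Fin d) ℝ)).star

instance (d : ℕ) : CompactSpace (SO d) := by
  refine isCompact_iff_compactSpace.mp ?_
  have hK : IsCompact (Set.pi univ fun _ : Fin d => Set.pi univ fun _ : Fin d => Icc (-1 : ℝ) 1) :=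
    isCompact_univ_pi fun _ => isCompact_univ_pi fun _ => isCompact_Icc
  refine IsCompact.of_isClosed_subset (X := Matrix (Fin d) (Fin d) ℝ) hK ?_ ?_
  · have h : (Matrix.specialOrthogonalGroup (Fin d) ℝ : Set (Matrix (Fin d) (Fin d) ℝ)) =
        {M | M * M.transpose = 1} ∩ {M | M.det = 1} := by
      ext M
      exact and_congr (Matrix.mem_orthogonalGroup_iff (Fin d) ℝ) Iff.rfl
    rw [h]
    exact (isClosed_eq (by fun_prop) continuous_const).inter
      (isClosed_eq (by fun_prop) continuous_const)
  · intro M hM i _ j _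
    have h := entry_norm_bound_of_unitary (𝕜 := ℝ) (U := M) hM.1 i j
    exact abs_le.mp h

/-- The Borel `σ`-algebra of `SO(d)`. -/
instance (d : ℕ) : MeasurableSpace (SO d) := borel _

instance (d : ℕ) : BorelSpace (SO d) := ⟨rfl⟩

/-- The Haar probability measure on `SO(d)`. -/
def haarSO (d : ℕ) : Measure (SO d) := Measure.haarMeasure ⊤

/-- The action of `SO(d)` on `ℝ^d`. -/
def rot {d : ℕ} (U : SO d) (v : E d) : E d := Matrix.toEuclideanLin U.1 v

/-- The vertex set `{0, v_1, …, v_k}`. -/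
def simplex {d k : ℕ} (v : Fin k → E d) : Set (E d) := insert 0 (range v)

/-- `c_Δ = min_j dist (v_j, span {v_i : i ≠ j})`. -/
def simplexWidth {d k : ℕ} (v : Fin k → E d) : ℝ :=
  ⨅ j : Fin k, Metric.infDist (v j) (Submodule.span ℝ (v '' {j}ᶜ) : Set (E d))

/-- `A` contains a set `x + l · U(Δ)` with `x ∈ ℝ^d` and `U ∈ SO(d)`. -/
def ContainsCopy {d : ℕ} (A : Set (E d)) (l : ℝ) (Δ : Set (E d)) : Prop :=
  ∃ (x : E d) (U : SO d), (fun p => x + l • rot U p) '' Δ ⊆ A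

/-- `∬ 1_A(x) 1_A(x - l U v_1) ⋯ 1_A(x - l U v_k) dμ(U) dx`. -/
def simplexCount {d k : ℕ} (A : Set (E d)) (v : Fin k → E d) (l : ℝ) : ℝ :=
  ∫ x : E d, ∫ U : SO d,
    A.indicator (fun _ => (1 : ℝ)) x *
      ∏ j : Fin k, A.indicator (fun _ => (1 : ℝ)) (x - l • rot U (v j)) ∂(haarSO d)

end Simplices

end

noncomputable section

namespace Simplices

/-! ### Rotations and Haar measure -/

/-! For (1), the factors 1_A(x - l U v_j) are replaced one at a time by α 1_{[0,1]^d}. After all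
replacements the form equals α^{k+1} up to O(lR), lost near the boundary of the cube. Each
replacement costs a form in which one factor is f = 1_A - α 1_{[0,1]^d}. The core is therefore a
generalized von Neumann inequality, `sq_simplexForm_le`: such a form is small if f is small in L²
after averaging over cubes of side L.

Let e be the direction of the component of v_j orthogonal to the other v_i, and let e' be a unit
vector orthogonal to all v_i, which exists since k < d. Rotations H_θ in the plane of e, e' fix
every v_i with i ≠ j and move v_j along a circle of radius r ≥ c_Δ. By right invariance of Haar
measure U may be replaced by U H_θ and averaged over θ. Cauchy-Schwarz in (x, U) removes the other
factors (`sq_integral_le_integral_corr`) and leaves the autocorrelation of f, averaged over all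
rotations of the chords of a circle of radius lr.

In place of Fourier decay, an elementary fact is used: spherical averages whose radius runs over
chord lengths change by only O(√(|h|/(lr))) under a shift by h, because two balls of radius s with
centres |h| apart differ by a set of volume O(|h| s^{d-1}). Averaging over shifts h = z - z' with z,
z' in Q_L then bounds the autocorrelation term by the squared L² norm of f averaged over cubes,
which is ε² + O(L) by uniform distribution. With L = ε⁴l and c = c_Δ ≤ 1 the form is O(ε c^{-1/4}) =
O(X^{3/2}), where X = c^{-1/6} ε^{2/3}. This is O(X) if X ≤ 1, and for X > 1 the estimate is
trivial.

For (2), a huge cube in which the density of A nearly attains δ* is rescaled to the unit cube. No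
cube of large side has density much above δ*, and local densities whose mean is close to their upper
bound are nearly constant in L². So the rescaled set is uniformly distributed and the counting
estimate `abs_simplexCount_sub_le` applies. -/

theorem rot_sub {d : ℕ} (U : SO d) (x y : E d) : rot U (x - y) = rot U x - rot U y :=
  map_sub _ x y

theorem rot_neg {d : ℕ} (U : SO d) (x : E d) : rot U (-x) = -rot U x :=
  map_neg _ x

theorem rot_smul {d : ℕ} (U : SO d) (a : ℝ) (x : E d) : rot U (a • x) = a • rot U x :=
  map_smul _ a x

theorem rot_zero {d : ℕ} (U : SO d) : rot U (0 : E d) = 0 :=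
  map_zero _

theorem rot_mul {d : ℕ} (U V : SO d) (x : E d) : rot (U * V) x = rot U (rot V x) := by
  ext i
  simp [rot]

theorem rot_one {d : ℕ} (x : E d) : rot (1 : SO d) x = x := by
  ext i
  simp [rot]

theorem continuous_rot {d : ℕ} : Continuous fun p : SO d × E d => rot p.1 p.2 := by
  unfold rot
  simp only [Matrix.toLpLin_apply]
  refine (PiLp.continuous_toLp 2 _).comp ?_
  refine Continuous.matrix_mulVec (continuous_subtype_val.comp continuous_fst) ?_
  exact (PiLp.continuous_ofLp 2 _).comp continuous_snd

theorem norm_rot {d : ℕ} (U : SO d) (x : E d) : ‖rot U x‖ = ‖x‖ := by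
  have h : U.1.transpose * U.1 = 1 := (Matrix.mem_orthogonalGroup_iff' (Fin d) ℝ).1 U.2.1
  have key : inner ℝ (rot U x) (rot U x) = inner ℝ x x := by
    rw [EuclideanSpace.inner_eq_star_dotProduct, EuclideanSpace.inner_eq_star_dotProduct]
    simp only [rot, Matrix.toLpLin_apply, star_trivial]
    rw [Matrix.dotProduct_mulVec, ← Matrix.mulVec_transpose, Matrix.mulVec_mulVec, h,
      Matrix.one_mulVec]
  rw [real_inner_self_eq_norm_sq, real_inner_self_eq_norm_sq] at key
  exact (sq_eq_sq₀ (norm_nonneg _) (norm_nonneg _)).1 key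

/-- The rotation as a linear isometry. -/
def rotIsometry {d : ℕ} (U : SO d) : E d →ₗᵢ[ℝ] E d where
  toLinearMap := Matrix.toEuclideanLin U.1
  norm_map' := norm_rot U

theorem measurePreserving_rot {d : ℕ} (U : SO d) : MeasurePreserving (rot (d := d) U) :=
  ((rotIsometry U).toLinearIsometryEquiv rfl).measurePreserving

theorem exists_rot_eq {d : ℕ} (f : E d ≃ₗᵢ[ℝ] E d)
    (hf : LinearMap.det (f.toLinearEquiv : E d →ₗ[ℝ] E d) = 1) :
    ∃ U : SO d, ∀ x, rot U x = f x := by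
  let b := EuclideanSpace.basisFun (Fin d) ℝ
  refine ⟨⟨LinearMap.toMatrix b.toBasis b.toBasis (f.toLinearEquiv : E d →ₗ[ℝ] E d), ?_, ?_⟩,
    fun x => ?_⟩
  · exact f.toMatrix_mem_unitaryGroup b b
  · change Matrix.det _ = 1
    rw [LinearMap.det_toMatrix, hf]
  · unfold rot
    rw [Matrix.toEuclideanLin_eq_toLin_orthonormal, Matrix.toLin_toMatrix]
    rfl

theorem isometry_det_mul_self {d : ℕ} (f : E d ≃ₗᵢ[ℝ] E d) :
    LinearMap.det (f.toLinearEquiv : E d →ₗ[ℝ] E d) *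
      LinearMap.det (f.toLinearEquiv : E d →ₗ[ℝ] E d) = 1 := by
  let b := EuclideanSpace.basisFun (Fin d) ℝ
  have h := f.toMatrix_mem_unitaryGroup b b
  have h2 := congrArg Matrix.det ((Matrix.mem_orthogonalGroup_iff (Fin d) ℝ).1 h)
  rw [Matrix.det_mul, Matrix.det_one] at h2
  have h3 := LinearMap.det_toMatrix b.toBasis (f.toLinearEquiv : E d →ₗ[ℝ] E d)
  rw [← h3]
  simpa [Matrix.star_eq_conjTranspose] using h2

instance (d : ℕ) : IsProbabilityMeasure (haarSO d) :=
  ⟨by simpa [haarSO] using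
    Measure.haarMeasure_self (K₀ := (⊤ : TopologicalSpace.PositiveCompacts (SO d)))⟩

instance (d : ℕ) : (haarSO d).IsHaarMeasure := by
  unfold haarSO; infer_instance

/-- A right translate of Haar measure is again a left Haar probability measure, and that is unique.
-/
instance (d : ℕ) : (haarSO d).IsMulRightInvariant where
  map_mul_right_eq_self g := by
    have : IsProbabilityMeasure (Measure.map (· * g) (haarSO d)) :=
      Measure.isProbabilityMeasure_map (by fun_prop)
    exact Measure.isHaarMeasure_eq_of_isProbabilityMeasure _ _

instance (d : ℕ) : SecondCountableTopology (SO d) :=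
  haveI : SecondCountableTopology (Matrix (Fin d) (Fin d) ℝ) :=
    inferInstanceAs (SecondCountableTopology (Fin d → Fin d → ℝ))
  (Topology.IsInducing.subtypeVal
    (t := {M | M ∈ Matrix.specialOrthogonalGroup (Fin d) ℝ})).secondCountableTopology

/-- The rotation by the angle `θ` in the oriented plane of the orthonormal pair `e`, `e'`, as a
linear map. -/
def planeRotation {d : ℕ} (e e' : E d) (θ : ℝ) : E d →ₗ[ℝ] E d where
  toFun x := x + ((Real.cos θ - 1) * inner ℝ e x - Real.sin θ * inner ℝ e' x) • e +
    ((Real.cos θ - 1) * inner ℝ e' x + Real.sin θ * inner ℝ e x) • e'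
  map_add' x y := by
    simp only [inner_add_right]
    module
  map_smul' a x := by
    simp only [inner_smul_right, RingHom.id_apply]
    module

theorem planeRotation_apply {d : ℕ} (e e' : E d) (θ : ℝ) (x : E d) :
    planeRotation e e' θ x =
      x + ((Real.cos θ - 1) * inner ℝ e x - Real.sin θ * inner ℝ e' x) • e +
        ((Real.cos θ - 1) * inner ℝ e' x + Real.sin θ * inner ℝ e x) • e' := rfl

theorem planeRotation_add {d : ℕ} {e e' : E d} (he : ‖e‖ = 1) (he' : ‖e'‖ = 1)
    (hee : inner ℝ e e' = 0) (a b : ℝ) :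
    planeRotation e e' (a + b) = planeRotation e e' a ∘ₗ planeRotation e e' b := by
  ext1 x
  have hee' : inner ℝ e' e = 0 := by rw [real_inner_comm, hee]
  simp only [LinearMap.comp_apply, planeRotation_apply, inner_add_right, inner_smul_right,
    real_inner_self_eq_norm_sq, he, he', hee, hee', Real.cos_add, Real.sin_add]
  module

theorem norm_planeRotation {d : ℕ} {e e' : E d} (he : ‖e‖ = 1) (he' : ‖e'‖ = 1)
    (hee : inner ℝ e e' = 0) (θ : ℝ) (x : E d) : ‖planeRotation e e' θ x‖ = ‖x‖ := by
  have hee' : inner ℝ e' e = 0 := by rw [real_inner_comm, hee]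
  have key : inner ℝ (planeRotation e e' θ x) (planeRotation e e' θ x) = inner ℝ x x := by
    simp only [planeRotation_apply, inner_add_right, inner_smul_right, inner_add_left,
      inner_smul_left, real_inner_self_eq_norm_sq e, real_inner_self_eq_norm_sq e', he, he', hee,
      hee', real_inner_comm x, conj_trivial]
    have h := Real.sin_sq_add_cos_sq θ
    rw [real_inner_comm e x, real_inner_comm e' x]
    linear_combination ((inner ℝ e x) ^ 2 + (inner ℝ e' x) ^ 2) * h
  rw [real_inner_self_eq_norm_sq, real_inner_self_eq_norm_sq] at key
  exact (sq_eq_sq₀ (norm_nonneg _) (norm_nonneg _)).1 key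

/-- The determinant is 1 because the rotation by θ is the square of the rotation by θ/2, and the
determinant of an isometry squares to 1. -/
theorem exists_rot_eq_planeRotation {d : ℕ} {e e' : E d} (he : ‖e‖ = 1) (he' : ‖e'‖ = 1)
    (hee : inner ℝ e e' = 0) (θ : ℝ) : ∃ U : SO d, ∀ x, rot U x = planeRotation e e' θ x := by
  let f : ℝ → (E d ≃ₗᵢ[ℝ] E d) := fun a =>
    (LinearIsometry.mk (planeRotation e e' a)
      (norm_planeRotation he he' hee a)).toLinearIsometryEquiv rfl
  have hf : ∀ a, ((f a).toLinearEquiv : E d →ₗ[ℝ] E d) = planeRotation e e' a := fun a => by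
    ext1 x; rfl
  obtain ⟨U, hU⟩ := exists_rot_eq (f θ) (by
    rw [hf, ← add_halves θ, planeRotation_add he he' hee, LinearMap.det_comp, ← hf]
    exact isometry_det_mul_self _)
  exact ⟨U, hU⟩

theorem exists_unit_orthogonal {d : ℕ} (S : Submodule ℝ (E d)) (hS : Module.finrank ℝ S < d) :
    ∃ e : E d, ‖e‖ = 1 ∧ ∀ x ∈ S, inner ℝ e x = 0 := by
  have hne : Sᗮ ≠ ⊥ := by
    intro h
    have := Submodule.finrank_add_finrank_orthogonal S
    rw [h, finrank_bot, finrank_euclideanSpace_fin] at this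
    omega
  obtain ⟨y, hy, hy0⟩ := Submodule.exists_mem_ne_zero_of_ne_bot hne
  refine ⟨‖y‖⁻¹ • y, norm_smul_inv_norm hy0, fun x hx => ?_⟩
  rw [inner_smul_left, Submodule.inner_left_of_mem_orthogonal hx hy, mul_zero]

/-- Transitivity of SO(d) on spheres: a plane rotation suffices, in a plane through x and y. When y
is parallel to x, any unit vector orthogonal to x completes the plane, which needs d ≥ 2. -/
theorem exists_rot_eq_of_norm_eq {d : ℕ} (hd : 2 ≤ d) {x y : E d} (h : ‖x‖ = ‖y‖) :
    ∃ U : SO d, rot U x = y := by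
  rcases eq_or_ne x 0 with rfl | hx
  · exact ⟨1, by rw [rot_one, eq_comm, ← norm_eq_zero, ← h, norm_zero]⟩
  have hn : ‖x‖ ≠ 0 := norm_ne_zero_iff.2 hx
  set e := ‖x‖⁻¹ • x with he_def
  have he : ‖e‖ = 1 := norm_smul_inv_norm hx
  have hxe : x = ‖x‖ • e := by rw [he_def, smul_smul, mul_inv_cancel₀ hn, one_smul]
  obtain ⟨e', he', hee, a, b, hab, hy⟩ : ∃ e' : E d, ‖e'‖ = 1 ∧ inner ℝ e e' = 0 ∧
      ∃ a b : ℝ, a ^ 2 + b ^ 2 = 1 ∧ y = ‖x‖ • (a • e + b • e') := by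
    set z := ‖x‖⁻¹ • y with hz
    have hyz : y = ‖x‖ • z := by rw [hz, smul_smul, mul_inv_cancel₀ hn, one_smul]
    have hz1 : ‖z‖ = 1 := by
      rw [hz, norm_smul, norm_inv, norm_norm, ← h, inv_mul_cancel₀ hn]
    set w := z - inner ℝ e z • e with hw
    have hew : inner ℝ e w = 0 := by
      rw [hw, inner_sub_right, inner_smul_right (r := inner ℝ e z), real_inner_self_eq_norm_sq, he]
      ring
    obtain ⟨e', he', hee, b, hb⟩ : ∃ e' : E d, ‖e'‖ = 1 ∧ inner ℝ e e' = 0 ∧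
        ∃ b : ℝ, w = b • e' := by
      rcases eq_or_ne w 0 with h0 | h0
      · obtain ⟨e', he', h'⟩ := exists_unit_orthogonal (ℝ ∙ e)
          ((finrank_span_singleton (K := ℝ)
            (norm_ne_zero_iff.1 (by rw [he]; exact one_ne_zero))).trans_lt (by omega))
        exact ⟨e', he', by rw [real_inner_comm]; exact h' e (Submodule.mem_span_singleton_self e),
          0, by rw [h0, zero_smul]⟩
      · exact ⟨‖w‖⁻¹ • w, norm_smul_inv_norm h0, by rw [inner_smul_right, hew, mul_zero], ‖w‖, by
          rw [smul_smul, mul_inv_cancel₀ (norm_ne_zero_iff.2 h0), one_smul]⟩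
    have hzz : z = inner ℝ e z • e + b • e' := by rw [← hb, hw]; abel
    refine ⟨e', he', hee, inner ℝ e z, b, ?_, by rw [← hzz, ← hyz]⟩
    have h1 : inner ℝ z z = 1 := by rw [real_inner_self_eq_norm_sq, hz1, one_pow]
    generalize inner ℝ e z = a at hzz
    have hee' : inner ℝ e' e = 0 := by rw [real_inner_comm, hee]
    rw [hzz] at h1
    simp only [inner_add_right, inner_smul_right, inner_add_left, inner_smul_left,
      real_inner_self_eq_norm_sq, he, he', hee, hee', conj_trivial] at h1
    linarith
  obtain ⟨θ, hc, hs⟩ : ∃ θ : ℝ, Real.cos θ = a ∧ Real.sin θ = b := by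
    have hz : ‖(⟨a, b⟩ : ℂ)‖ = 1 := by
      rw [Complex.norm_def, Complex.normSq_mk, ← sq, ← sq, hab, Real.sqrt_one]
    refine ⟨Complex.arg ⟨a, b⟩, ?_, ?_⟩
    · rw [Complex.cos_arg (norm_ne_zero_iff.1 (by rw [hz]; exact one_ne_zero)), hz, div_one]
    · rw [Complex.sin_arg, hz, div_one]
  obtain ⟨U, hU⟩ := exists_rot_eq_planeRotation he he' hee θ
  refine ⟨U, ?_⟩
  have hee' : inner ℝ e' e = 0 := by rw [real_inner_comm, hee]
  rw [hU, hy, hxe, map_smul, planeRotation_apply, real_inner_self_eq_norm_sq, he, hee', hc, hs,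
    norm_smul, norm_norm, he, mul_one]
  module

/-- The count is written with x - l U v_j and a copy with x + l U v_j; this rotation reconciles the
two. -/
theorem exists_rot_eq_neg {d k : ℕ} (hd : k + 1 ≤ d) (v : Fin k → E d) :
    ∃ S : SO d, ∀ j, rot S (v j) = -v j := by
  have hfin : Module.finrank ℝ (Submodule.span ℝ (range v)) ≤ k := by
    have h := finrank_range_le_card (R := ℝ) v
    rwa [Fintype.card_fin] at h
  obtain ⟨e, he, hev⟩ := exists_unit_orthogonal (Submodule.span ℝ (range v)) (by omega)
  -- If -1 has determinant -1, compose it with the reflection in the hyperplane orthogonal to e.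
  -- This corrects the determinant and fixes every v_j.
  by_cases hdet : LinearMap.det
      ((LinearIsometryEquiv.neg ℝ : E d ≃ₗᵢ[ℝ] E d).toLinearEquiv : E d →ₗ[ℝ] E d) = 1
  · obtain ⟨S, hS⟩ := exists_rot_eq _ hdet
    exact ⟨S, fun j => by rw [hS]; rfl⟩
  · let K : Submodule ℝ (E d) := ℝ ∙ e
    have hdet2 : LinearMap.det ((Kᗮ.reflection).toLinearEquiv : E d →ₗ[ℝ] E d) = -1 := by
      rw [Submodule.det_reflection, Submodule.orthogonal_orthogonal,
        finrank_span_singleton (norm_ne_zero_iff.1 (by rw [he]; exact one_ne_zero)), pow_one]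
    have hneg := isometry_det_mul_self (LinearIsometryEquiv.neg ℝ : E d ≃ₗᵢ[ℝ] E d)
    obtain ⟨S, hS⟩ := exists_rot_eq
      ((Kᗮ.reflection).trans (LinearIsometryEquiv.neg ℝ : E d ≃ₗᵢ[ℝ] E d)) (by
        have hc : (((Kᗮ.reflection).trans
            (LinearIsometryEquiv.neg ℝ : E d ≃ₗᵢ[ℝ] E d)).toLinearEquiv : E d →ₗ[ℝ] E d) =
          ((LinearIsometryEquiv.neg ℝ : E d ≃ₗᵢ[ℝ] E d).toLinearEquiv : E d →ₗ[ℝ] E d) ∘ₗ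
            ((Kᗮ.reflection).toLinearEquiv : E d →ₗ[ℝ] E d) := rfl
        rw [hc, LinearMap.det_comp, hdet2]
        rcases mul_self_eq_one_iff.1 hneg with h | h
        · exact absurd h hdet
        · rw [h]; norm_num)
    refine ⟨S, fun j => ?_⟩
    rw [hS]
    have hmem : v j ∈ Kᗮ := by
      rw [Submodule.mem_orthogonal_singleton_iff_inner_right]
      exact hev _ (Submodule.subset_span (mem_range_self j))
    change -(Kᗮ.reflection (v j)) = _
    rw [Submodule.reflection_mem_subspace_eq_self hmem]

/-! ### Regularity of averages over spheres of varying radius -/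

/-- Transitivity on spheres with right invariance makes a rotation average a function of the norm
alone, that is, a spherical average. -/
theorem integral_rot_congr {d : ℕ} (hd : 2 ≤ d) (F : E d → ℝ) {x y : E d} (h : ‖x‖ = ‖y‖) :
    ∫ U, F (rot U x) ∂haarSO d = ∫ U, F (rot U y) ∂haarSO d := by
  obtain ⟨V, rfl⟩ := exists_rot_eq_of_norm_eq hd h
  simp_rw [← rot_mul]
  exact (integral_mul_right_eq_self (fun U => F (rot U x)) V).symm

theorem continuous_rot_left {d : ℕ} (x : E d) : Continuous fun U : SO d => rot U x :=
  continuous_rot.comp (by fun_prop : Continuous fun U : SO d => (U, x))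

theorem integrable_haarSO_of_continuous {d : ℕ} {g : SO d → ℝ} (hg : Continuous g) :
    Integrable g (haarSO d) :=
  hg.integrable_of_hasCompactSupport (HasCompactSupport.of_compactSpace g)

theorem continuous_integral_rot {d : ℕ} {D : E d → ℝ} (hD : Continuous D) (e : E d) :
    Continuous fun s : ℝ => ∫ U, D (rot U (s • e)) ∂haarSO d := by
  have h := continuous_parametric_integral_of_continuous (μ := haarSO d)
    (f := fun (s : ℝ) (U : SO d) => D (rot U (s • e)))
    (hD.comp (continuous_rot.comp (by fun_prop : Continuous fun p : ℝ × SO d => (p.2, p.1 • e))))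
    isCompact_univ
  simpa only [setIntegral_univ] using h

/-- The ball and its translate both lie in the ball of radius s + ‖h‖, so each integral misses only
the volume of a shell. The condition ‖h‖ ≤ s keeps the outer radius below 2s. -/
theorem abs_integral_ball_sub_shift_le {d : ℕ} (hd : 2 ≤ d) {F : E d → ℝ} (hF : Continuous F)
    (hb : ∀ x, |F x| ≤ 1) (h : E d) {s : ℝ} (hs : 0 < s) (hhs : ‖h‖ ≤ s) :
    |∫ x in Metric.ball (0 : E d) s, (F x - F (x + h))| ≤
      volume.real (Metric.ball (0 : E d) 1) * (2 ^ d * d * ‖h‖ * s ^ (d - 1)) := by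
  have : Nontrivial (E d) := Module.nontrivial_of_finrank_pos (R := ℝ)
    (by rw [finrank_euclideanSpace_fin]; omega)
  have hint : ∀ (c : E d) (r : ℝ), IntegrableOn F (Metric.ball c r) := fun c r =>
    (hF.continuousOn.integrableOn_compact (isCompact_closedBall c r)).mono_set
      Metric.ball_subset_closedBall
  have hshift : ∫ x in Metric.ball (0 : E d) s, F (x + h) = ∫ x in Metric.ball h s, F x := by
    have := (measurePreserving_add_right (volume : Measure (E d)) h).setIntegral_preimage_emb
      (measurableEmbedding_addRight h) F (Metric.ball h s)
    rw [← this]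
    congr 2
    ext x
    simp [dist_eq_norm]
  have hint2 : IntegrableOn (fun x => F (x + h)) (Metric.ball 0 s) :=
    ((hF.comp (continuous_add_const h)).continuousOn.integrableOn_compact
      (isCompact_closedBall 0 s)).mono_set Metric.ball_subset_closedBall
  rw [integral_sub (hint 0 s) hint2, hshift]
  set B := Metric.ball (0 : E d) (s + ‖h‖) with hB
  have hvol : ∀ (c : E d) (r : ℝ), 0 ≤ r → volume.real (Metric.ball c r) =
      r ^ d * volume.real (Metric.ball (0 : E d) 1) := fun c r hr => by
    rw [Measure.real, Measure.addHaar_ball _ _ hr, ENNReal.toReal_mul, finrank_euclideanSpace_fin,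
      ENNReal.toReal_ofReal (by positivity), Measure.real]
  have hdiff : ∀ c : E d, Metric.ball c s ⊆ B →
      |(∫ x in B, F x) - ∫ x in Metric.ball c s, F x| ≤
        ((s + ‖h‖) ^ d - s ^ d) * volume.real (Metric.ball (0 : E d) 1) := fun c hc => by
    rw [← setIntegral_sdiff measurableSet_ball (hint _ _) hc]
    have h1 := norm_setIntegral_le_of_norm_le_const (μ := volume) (s := B \ Metric.ball c s)
      (f := F) (C := 1)
      ((measure_mono sdiff_subset).trans_lt measure_ball_lt_top) (fun x _ => hb x)
    rw [one_mul, measureReal_sdiff hc measurableSet_ball measure_ball_lt_top.ne,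
      hvol _ _ (by positivity), hvol _ _ hs.le] at h1
    rw [← Real.norm_eq_abs]
    linarith
  have h0 := hdiff 0 (Metric.ball_subset_ball (by linarith [norm_nonneg h]))
  have h1 := hdiff h (Metric.ball_subset_ball' (by simp))
  have hpow : (s + ‖h‖) ^ d - s ^ d ≤ ‖h‖ * d * (2 * s) ^ (d - 1) := by
    have h2 := (le_abs_self _).trans (abs_pow_sub_pow_le (s + ‖h‖) s d)
    rw [add_sub_cancel_left, abs_of_nonneg (norm_nonneg h), abs_of_nonneg hs.le,
      abs_of_nonneg (by positivity : 0 ≤ s + ‖h‖), max_eq_left (by linarith [norm_nonneg h])] at h2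
    refine h2.trans ?_
    gcongr
    linarith
  have hω : 0 ≤ volume.real (Metric.ball (0 : E d) 1) := measureReal_nonneg
  have h2d : (2 : ℝ) ^ d = 2 * 2 ^ (d - 1) := by
    rw [← pow_succ', Nat.sub_add_cancel (by omega)]
  calc |(∫ x in Metric.ball 0 s, F x) - ∫ x in Metric.ball h s, F x|
      = |((∫ x in B, F x) - ∫ x in Metric.ball h s, F x) -
          ((∫ x in B, F x) - ∫ x in Metric.ball 0 s, F x)| := by congr 1; ring
    _ ≤ 2 * (((s + ‖h‖) ^ d - s ^ d) * volume.real (Metric.ball (0 : E d) 1)) :=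
        (abs_sub _ _).trans (by linarith)
    _ ≤ 2 * ((‖h‖ * d * (2 * s) ^ (d - 1)) * volume.real (Metric.ball (0 : E d) 1)) := by gcongr
    _ = _ := by rw [h2d, mul_pow]; ring

/-- The ball estimate in polar coordinates: averaging over rotations does not change the integral
over a centred ball and makes the integrand radial. The factor d times the volume of the unit ball
cancels on both sides. -/
theorem abs_integral_radial_le {d : ℕ} (hd : 2 ≤ d) {F : E d → ℝ} (hF : Continuous F)
    (hb : ∀ x, |F x| ≤ 1) (h : E d) {e : E d} (he : ‖e‖ = 1) {s : ℝ} (hs : 0 < s)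
    (hhs : ‖h‖ ≤ s) :
    |∫ u in (0 : ℝ)..s,
        (∫ U, (F (rot U (u • e)) - F (rot U (u • e) + h)) ∂haarSO d) * u ^ (d - 1)| ≤
      2 ^ d * ‖h‖ * s ^ (d - 1) := by
  have : Nontrivial (E d) := Module.nontrivial_of_finrank_pos (R := ℝ)
    (by rw [finrank_euclideanSpace_fin]; omega)
  set D : E d → ℝ := fun x => F x - F (x + h) with hD
  have hDc : Continuous D := by fun_prop
  set N : ℝ → ℝ := fun u => ∫ U, D (rot U (u • e)) ∂haarSO d with hN
  set ω := volume.real (Metric.ball (0 : E d) 1) with hω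
  have hωpos : 0 < ω := ENNReal.toReal_pos (Metric.measure_ball_pos _ _ one_pos).ne'
    measure_ball_lt_top.ne
  have hrot : ∀ U : SO d, ∫ x in Metric.ball (0 : E d) s, D (rot U x) =
      ∫ x in Metric.ball (0 : E d) s, D x := fun U => by
    have h1 := (measurePreserving_rot U).setIntegral_preimage_emb
      (((rotIsometry U).toLinearIsometryEquiv rfl).toHomeomorph.measurableEmbedding) D
      (Metric.ball 0 s)
    rw [← h1]
    congr 2
    ext x
    simp [norm_rot]
  have hswap : ∫ x in Metric.ball (0 : E d) s, D x =
      ∫ x in Metric.ball (0 : E d) s, N ‖x‖ := by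
    calc ∫ x in Metric.ball (0 : E d) s, D x
        = ∫ U, (∫ x in Metric.ball (0 : E d) s, D (rot U x)) ∂haarSO d := by
          simp_rw [hrot]; simp
      _ = ∫ x in Metric.ball (0 : E d) s, ∫ U, D (rot U x) ∂haarSO d := by
          refine integral_integral_swap ?_
          have hc : Continuous (Function.uncurry fun (U : SO d) (x : E d) => D (rot U x)) :=
            hDc.comp continuous_rot
          have hbd : ∀ p, ‖Function.uncurry (fun (U : SO d) (x : E d) => D (rot U x)) p‖ ≤ 2 :=
            fun p => (norm_sub_le _ _).trans (by
              rw [Real.norm_eq_abs, Real.norm_eq_abs]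
              linarith [hb (rot p.1 p.2), hb (rot p.1 p.2 + h)])
          have : IsFiniteMeasure (volume.restrict (Metric.ball (0 : E d) s)) :=
            isFiniteMeasure_restrict.2 measure_ball_lt_top.ne
          exact Integrable.of_bound hc.aestronglyMeasurable 2 (ae_of_all _ hbd)
      _ = ∫ x in Metric.ball (0 : E d) s, N ‖x‖ := by
          refine integral_congr_ae (ae_of_all _ fun x => ?_)
          exact integral_rot_congr hd D (by rw [norm_smul, he, norm_norm, mul_one])
  have hpolar : ∫ x in Metric.ball (0 : E d) s, N ‖x‖ =
      d * ω * ∫ u in (0 : ℝ)..s, N u * u ^ (d - 1) := by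
    have h1 := integral_fun_norm_addHaar (volume : Measure (E d)) ((Iio s).indicator N)
    rw [finrank_euclideanSpace_fin, nsmul_eq_mul, smul_eq_mul, ← hω, ← mul_assoc] at h1
    rw [← integral_indicator measurableSet_ball]
    convert h1 using 1
    · congr 1
      ext x
      simp [indicator]
    · congr 1
      rw [intervalIntegral.integral_of_le hs.le, integral_Ioc_eq_integral_Ioo,
        ← integral_indicator measurableSet_Ioi, ← integral_indicator measurableSet_Ioo]
      congr 1
      ext u
      by_cases h0 : 0 < u <;> by_cases h1 : u < s <;> simp [indicator, h0, h1, mul_comm]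
  have hfin := abs_integral_ball_sub_shift_le hd hF hb h hs hhs
  rw [hswap, hpolar, abs_mul, abs_of_nonneg (by positivity)] at hfin
  refine le_of_mul_le_mul_left (hfin.trans_eq ?_) (by positivity : 0 < d * ω)
  ring

/-- A bound on the weighted primitive of N passes to an average of N over the radii b sin(τ/2).
Angles below q = √(t/b) are bounded trivially. Above q the change of variable is nondegenerate, so
integration by parts against the primitive applies, and the factor s^n in its bound cancels the
weight. The balance of the two ranges gives the square root. -/
theorem abs_integral_comp_sin_le {N : ℝ → ℝ} (hN : Continuous N) (hN2 : ∀ u, |N u| ≤ 2) {n : ℕ}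
    {K t b : ℝ} (hK : 0 ≤ K) (ht : 0 < t) (hb : 0 < b)
    (hW : ∀ s, 0 < s → t ≤ s → |∫ u in (0 : ℝ)..s, N u * u ^ n| ≤ K * t * s ^ n)
    {T : ℝ} (hT0 : 0 ≤ T) (hT1 : T ≤ 1) :
    |∫ τ in (0 : ℝ)..T, N (b * Real.sin (τ / 2))| ≤ (8 + 4 * (n + 3) * K) * √(t / b) := by
  set q := √(t / b) with hq
  have hqpos : 0 < q := Real.sqrt_pos.2 (by positivity)
  have hqq : q * q = t / b := Real.mul_self_sqrt (by positivity)
  have hKq : 0 ≤ 4 * (n + 3) * K * q := by positivity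
  have htriv : ∀ T' ≥ 0, |∫ τ in (0 : ℝ)..T', N (b * Real.sin (τ / 2))| ≤ 2 * T' := fun T' hT' => by
    have := intervalIntegral.norm_integral_le_of_norm_le_const (a := 0) (b := T') (C := 2)
      (f := fun τ => N (b * Real.sin (τ / 2))) (fun x _ => hN2 _)
    rwa [sub_zero, abs_of_nonneg hT', Real.norm_eq_abs] at this
  -- For q > 1/4 the trivial bound 2T ≤ 2 is already below 8q.
  by_cases hq4 : 1 / 4 < q
  · have := htriv T hT0
    nlinarith
  by_cases hTq : T ≤ q
  · have := htriv T hT0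
    nlinarith
  push Not at hq4 hTq
  set s : ℝ → ℝ := fun τ => b * Real.sin (τ / 2) with hs
  set s' : ℝ → ℝ := fun τ => b / 2 * Real.cos (τ / 2) with hs'
  set W : ℝ → ℝ := fun x => ∫ u in (0 : ℝ)..x, N u * u ^ n with hWdef
  have hsd : ∀ τ, HasDerivAt s (s' τ) τ := fun τ => by
    have := ((Real.hasDerivAt_sin (τ / 2)).comp τ ((hasDerivAt_id τ).div_const 2)).const_mul b
    exact this.congr_deriv (by simp only [hs']; ring)
  have hs'd : ∀ τ, HasDerivAt s' (-(s τ / 4)) τ := fun τ => by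
    have := ((Real.hasDerivAt_cos (τ / 2)).comp τ ((hasDerivAt_id τ).div_const 2)).const_mul (b / 2)
    exact this.congr_deriv (by simp only [hs]; ring)
  have hsc : Continuous s := by fun_prop
  have hs'c : Continuous s' := by fun_prop
  have hWd : ∀ x, HasDerivAt W (N x * x ^ n) x := fun x => by
    have hc : Continuous fun u => N u * u ^ n := by fun_prop
    exact intervalIntegral.integral_hasDerivAt_right (hc.intervalIntegrable _ _)
      (hc.stronglyMeasurableAtFilter _ _) hc.continuousAt
  have hrange : ∀ τ ∈ uIcc q T, q ≤ τ ∧ τ ≤ T := fun τ hτ => by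
    rwa [uIcc_of_le hTq.le] at hτ
  have hslow : ∀ τ ∈ uIcc q T, b * q / 4 ≤ s τ := fun τ hτ => by
    obtain ⟨h1, h2⟩ := hrange τ hτ
    have h3 := Real.sin_gt_sub_cube (x := τ / 2) (by linarith)
    have h4 : τ / 4 ≤ Real.sin (τ / 2) := by nlinarith [sq_nonneg τ]
    simp only [hs]
    nlinarith
  have hs'low : ∀ τ ∈ uIcc q T, b / 4 ≤ s' τ := fun τ hτ => by
    obtain ⟨h1, h2⟩ := hrange τ hτ
    have h3 := Real.one_sub_sq_div_two_le_cos (x := τ / 2)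
    have h4 : 1 / 2 ≤ Real.cos (τ / 2) := by nlinarith
    simp only [hs']
    nlinarith
  have hspos : ∀ τ ∈ uIcc q T, 0 < s τ := fun τ hτ => lt_of_lt_of_le (by positivity) (hslow τ hτ)
  have hs'pos : ∀ τ ∈ uIcc q T, 0 < s' τ := fun τ hτ => lt_of_lt_of_le (by positivity) (hs'low τ hτ)
  -- Since t = b q² and q ≤ 1/4, the radius b q / 4 is still at least t, so the hypothesis on the
  -- primitive is available on the whole range.
  have hts : ∀ τ ∈ uIcc q T, t ≤ s τ := fun τ hτ => by
    have h1 : t = b * (q * q) := by rw [hqq]; field_simp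
    have := hslow τ hτ
    nlinarith [mul_pos hb hqpos]
  have hWs : ∀ τ ∈ uIcc q T, |W (s τ)| ≤ K * t * s τ ^ n := fun τ hτ =>
    hW _ (hspos τ hτ) (hts τ hτ)
  -- This weight makes N(s) equal to m times the derivative of W(s).
  set m : ℝ → ℝ := fun τ => (s τ ^ n * s' τ)⁻¹ with hm
  set m' : ℝ → ℝ := fun τ =>
    -((n * s τ ^ (n - 1) * s' τ) * s' τ + s τ ^ n * (-(s τ / 4))) / (s τ ^ n * s' τ) ^ 2 with hm'
  have hmd : ∀ τ ∈ uIcc q T, HasDerivAt m (m' τ) τ := fun τ hτ => by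
    have h1 := ((hsd τ).pow n).mul (hs'd τ)
    exact h1.inv (mul_pos (pow_pos (hspos τ hτ) n) (hs'pos τ hτ)).ne'
  have hGd : ∀ τ ∈ uIcc q T, HasDerivAt (fun τ => W (s τ)) (N (s τ) * s τ ^ n * s' τ) τ :=
    fun τ _ => (hWd (s τ)).comp τ (hsd τ)
  have hm'int : IntervalIntegrable m' volume q T := by
    refine ContinuousOn.intervalIntegrable ?_
    refine ContinuousOn.div (by fun_prop) (by fun_prop) fun τ hτ => ?_
    exact (pow_pos (mul_pos (pow_pos (hspos τ hτ) n) (hs'pos τ hτ)) 2).ne'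
  have hibp := intervalIntegral.integral_mul_deriv_eq_deriv_mul hmd hGd hm'int
    ((by fun_prop : Continuous fun τ => N (s τ) * s τ ^ n * s' τ).intervalIntegrable _ _)
  have hlhs : ∫ τ in q..T, m τ * (N (s τ) * s τ ^ n * s' τ) = ∫ τ in q..T, N (s τ) := by
    refine intervalIntegral.integral_congr fun τ hτ => ?_
    have h1 := (pow_pos (hspos τ hτ) n).ne'
    have h2 := (hs'pos τ hτ).ne'
    simp only [hm]
    field_simp
  have hKt : 0 ≤ K * t := by positivity
  have hmW : ∀ τ ∈ uIcc q T, |m τ * W (s τ)| ≤ 4 * K * q := fun τ hτ => by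
    have h1 := pow_pos (hspos τ hτ) n
    have h2 := hs'pos τ hτ
    rw [abs_mul, hm, abs_of_pos (by positivity)]
    calc (s τ ^ n * s' τ)⁻¹ * |W (s τ)| ≤ (s τ ^ n * s' τ)⁻¹ * (K * t * s τ ^ n) := by
          gcongr; exact hWs τ hτ
      _ = K * t / s' τ := by field_simp
      _ ≤ K * t / (b / 4) := by gcongr; exact hs'low τ hτ
      _ = 4 * K * (q * q) := by rw [hqq]; field_simp
      _ ≤ 4 * K * q := by
          have : q * q ≤ q := by nlinarith
          gcongr
  -- The dominant contribution is t n / s ≤ 4 n t / (b q) = 4 n q, as t / b = q².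
  have hm'W : ∀ τ ∈ uIcc q T, |m' τ * W (s τ)| ≤ 4 * (n + 1) * K * q := fun τ hτ => by
    have h0 := hspos τ hτ
    have h1 := pow_pos (hspos τ hτ) n
    have h2 := hs'pos τ hτ
    have hsn : (n : ℝ) * s τ ^ (n - 1) * s τ = n * s τ ^ n := by
      rcases Nat.eq_zero_or_pos n with rfl | hn
      · simp
      · rw [mul_assoc, pow_sub_one_mul (by omega)]
    have hms : |m' τ| * s τ ^ n ≤ n / s τ + s τ / 4 / s' τ ^ 2 := by
      have : m' τ * s τ ^ n = -(n / s τ) + s τ / 4 / s' τ ^ 2 := by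
        simp only [hm']
        field_simp
        linear_combination (-4 * s' τ ^ 2) * hsn
      rw [← abs_of_pos h1, ← abs_mul, this]
      refine (abs_add_le _ _).trans ?_
      rw [abs_neg, abs_of_nonneg (by positivity), abs_of_nonneg (by positivity)]
    have hsb : s τ ≤ b := by
      have := Real.sin_le_one (τ / 2)
      simp only [hs]; nlinarith
    rw [abs_mul]
    calc |m' τ| * |W (s τ)| ≤ |m' τ| * (K * t * s τ ^ n) := by gcongr; exact hWs τ hτ
      _ = K * t * (|m' τ| * s τ ^ n) := by ring
      _ ≤ K * t * (n / s τ + s τ / 4 / s' τ ^ 2) := by gcongr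
      _ ≤ K * t * (n / (b * q / 4) + b / 4 / (b / 4) ^ 2) := by
          gcongr
          · exact hslow τ hτ
          · exact hs'low τ hτ
      _ = K * (q * q) * (4 * n / q + 4) := by rw [hqq]; field_simp
      _ = 4 * K * q * (n + q) := by field_simp
      _ ≤ 4 * K * q * (n + 1) := by gcongr; linarith
      _ = _ := by ring
  have hmain : |∫ τ in q..T, N (s τ)| ≤ 4 * (n + 3) * K * q := by
    rw [← hlhs, hibp]
    have h1 := hmW T right_mem_uIcc
    have h2 := hmW q left_mem_uIcc
    have h3 : |∫ τ in q..T, m' τ * W (s τ)| ≤ 4 * (n + 1) * K * q := by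
      have h4 := intervalIntegral.norm_integral_le_of_norm_le_const (a := q) (b := T)
        (f := fun τ => m' τ * W (s τ)) (C := 4 * (n + 1) * K * q)
        (fun τ hτ => hm'W τ (uIoc_subset_uIcc hτ))
      rw [Real.norm_eq_abs, abs_of_pos (by linarith : 0 < T - q)] at h4
      refine h4.trans (mul_le_of_le_one_right (by positivity) (by linarith))
    refine (abs_sub _ _).trans ?_
    have h5 := abs_sub (m T * W (s T)) (m q * W (s q))
    nlinarith
  have hsplit := intervalIntegral.integral_add_adjacent_intervals (μ := volume) (a := 0) (b := q)
    (c := T) (f := fun τ => N (s τ)) ((by fun_prop : Continuous _).intervalIntegrable _ _)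
    ((by fun_prop : Continuous _).intervalIntegrable _ _)
  change |∫ τ in (0 : ℝ)..T, N (s τ)| ≤ _
  rw [← hsplit]
  refine (abs_add_le _ _).trans ?_
  have := htriv q hqpos.le
  change |∫ τ in (0 : ℝ)..q, N (s τ)| ≤ _ at this
  nlinarith

/-- The uniform probability measure on the angles in `(0, 1]`. -/
def angleMeasure : Measure ℝ := volume.restrict (Ioc 0 1)

instance : IsProbabilityMeasure angleMeasure := ⟨by simp [angleMeasure]⟩

theorem ae_angleMeasure : ∀ᵐ θ ∂angleMeasure, θ ∈ Ioc (0 : ℝ) 1 :=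
  ae_restrict_mem measurableSet_Ioc

/-- The constant in the regularity estimate for averages over chords. -/
def chordConst (d : ℕ) : ℝ := 2 * (8 + 4 * (d + 2) * 2 ^ d)

theorem chordConst_pos (d : ℕ) : 0 < chordConst d := by unfold chordConst; positivity

/-- The rotation average sees only the chord length b |sin((θ - θ')/2)|, so the bound for the radii
b sin(τ/2) applies on either side of θ = θ'. -/
theorem abs_integral_chord_shift_le {d : ℕ} (hd : 2 ≤ d) {F : E d → ℝ} (hF : Continuous F)
    (hb : ∀ x, |F x| ≤ 1) (h : E d) {b : ℝ} (hb0 : 0 < b) {θ' : ℝ} (hθ' : θ' ∈ Ioc (0 : ℝ) 1)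
    {w : ℝ → E d} (hw : ∀ θ, ‖w θ‖ = |b * Real.sin ((θ - θ') / 2)|) :
    |∫ θ, (∫ U, (F (rot U (w θ)) - F (rot U (w θ) + h)) ∂haarSO d) ∂angleMeasure| ≤
      chordConst d * √(‖h‖ / b) := by
  rcases eq_or_ne h 0 with rfl | hh
  · simp
  obtain ⟨e, he, -⟩ := exists_unit_orthogonal (⊥ : Submodule ℝ (E d)) (by rw [finrank_bot]; omega)
  set D : E d → ℝ := fun x => F x - F (x + h) with hD
  have hDc : Continuous D := by fun_prop
  set N : ℝ → ℝ := fun u => ∫ U, D (rot U (u • e)) ∂haarSO d with hN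
  have hNc : Continuous N := continuous_integral_rot hDc e
  have hNb : ∀ u, |N u| ≤ 2 := fun u => by
    have h1 := norm_integral_le_of_norm_le_const (μ := haarSO d) (C := 2)
      (f := fun U => D (rot U (u • e))) (ae_of_all _ fun U => (norm_sub_le _ _).trans (by
        rw [Real.norm_eq_abs, Real.norm_eq_abs]
        linarith [hb (rot U (u • e)), hb (rot U (u • e) + h)]))
    simpa using h1
  have hNeven : ∀ u, N (-u) = N u := fun u =>
    integral_rot_congr hd D (by rw [norm_smul, norm_smul, norm_neg])
  have hb1 : ∀ T, 0 ≤ T → T ≤ 1 → |∫ τ in (0 : ℝ)..T, N (b * Real.sin (τ / 2))| ≤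
      (8 + 4 * ((d - 1 : ℕ) + 3) * 2 ^ d) * √(‖h‖ / b) := fun T h0 h1 =>
    abs_integral_comp_sin_le hNc hNb (by positivity) (norm_pos_iff.2 hh) hb0
      (fun s hs hs' => abs_integral_radial_le hd hF hb h he hs hs') h0 h1
  have hd1 : ((d - 1 : ℕ) : ℝ) + 3 = d + 2 := by
    rw [Nat.cast_sub (by omega)]; push_cast; ring
  have hcont : Continuous fun τ => N (b * Real.sin (τ / 2)) := by fun_prop
  have hkey : ∫ θ, (∫ U, D (rot U (w θ)) ∂haarSO d) ∂angleMeasure =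
      (∫ τ in (0 : ℝ)..θ', N (b * Real.sin (τ / 2))) +
        ∫ τ in (0 : ℝ)..(1 - θ'), N (b * Real.sin (τ / 2)) := by
    have h1 : ∀ θ, ∫ U, D (rot U (w θ)) ∂haarSO d = N (b * Real.sin ((θ - θ') / 2)) := fun θ =>
      integral_rot_congr hd D (by rw [hw, norm_smul, he, mul_one, Real.norm_eq_abs])
    simp_rw [h1]
    rw [angleMeasure, ← intervalIntegral.integral_of_le zero_le_one,
      intervalIntegral.integral_comp_sub_right (fun τ => N (b * Real.sin (τ / 2))) θ', zero_sub,
      ← intervalIntegral.integral_add_adjacent_intervals (hcont.intervalIntegrable (-θ') 0)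
        (hcont.intervalIntegrable 0 (1 - θ'))]
    congr 1
    -- Angles θ < θ' are reflected to positive ones, using that N is even.
    rw [← neg_zero, ← intervalIntegral.integral_comp_neg, neg_zero]
    refine intervalIntegral.integral_congr fun τ _ => ?_
    rw [neg_div, Real.sin_neg, mul_neg, hNeven]
  change |∫ θ, (∫ U, D (rot U (w θ)) ∂haarSO d) ∂angleMeasure| ≤ _
  rw [hkey]
  have h1 := hb1 θ' hθ'.1.le hθ'.2
  have h2 := hb1 (1 - θ') (by linarith [hθ'.2]) (by linarith [hθ'.1])
  rw [hd1] at h1 h2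
  refine (abs_add_le _ _).trans ?_
  unfold chordConst
  linarith

/-! ### Autocorrelations -/

/-- The autocorrelation of a function. -/
def corr {d : ℕ} (f : E d → ℝ) (y : E d) : ℝ := ∫ x, f x * f (x - y)

/-- Measurable functions on `[0,1]^d` with values in `[-1,1]`, extended by zero. -/
structure IsUnitBounded {d : ℕ} (f : E d → ℝ) : Prop where
  measurable : Measurable f
  abs_le : ∀ x, |f x| ≤ 1
  eq_zero : ∀ x, x ∉ unitCube d → f x = 0

/-! ### Volume of the unit cube; integrability and continuity of autocorrelations -/

theorem unitCube_eq_preimage (d : ℕ) : unitCube d =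
    (WithLp.ofLp : E d → Fin d → ℝ) ⁻¹' Set.pi univ fun _ => Icc (0 : ℝ) 1 := by
  ext x
  exact ⟨fun h i _ => h i, fun h i => h i trivial⟩

theorem measurableSet_unitCube (d : ℕ) : MeasurableSet (unitCube d) := by
  rw [unitCube_eq_preimage]
  exact (EuclideanSpace.volume_preserving_symm_measurableEquiv_toLp (Fin d)).measurable
    (MeasurableSet.univ_pi fun _ => measurableSet_Icc)

theorem volume_pi_preimage (d : ℕ) (a b : Fin d → ℝ) :
    volume ((WithLp.ofLp : E d → Fin d → ℝ) ⁻¹' Set.pi univ fun i => Icc (a i) (b i)) =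
      ∏ i, ENNReal.ofReal (b i - a i) := by
  have h := (EuclideanSpace.volume_preserving_symm_measurableEquiv_toLp (Fin d)).measure_preimage
    (MeasurableSet.univ_pi fun i => measurableSet_Icc (a := a i) (b := b i)).nullMeasurableSet
  rw [← Real.volume_Icc_pi, ← pi_univ_Icc]
  exact h

theorem volume_unitCube (d : ℕ) : volume (unitCube d) = 1 := by
  rw [unitCube_eq_preimage, volume_pi_preimage]
  simp

theorem norm_le_of_abs_le {d : ℕ} {x : E d} {a : ℝ} (hx : ∀ i, |x i| ≤ a) : ‖x‖ ≤ d * a := by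
  rcases Nat.eq_zero_or_pos d with rfl | hd
  · simp [Subsingleton.elim x 0]
  have ha : 0 ≤ a := (abs_nonneg _).trans (hx ⟨0, hd⟩)
  rw [EuclideanSpace.norm_eq]
  refine Real.sqrt_le_iff.2 ⟨by positivity, ?_⟩
  calc ∑ i, ‖x i‖ ^ 2 ≤ ∑ _i : Fin d, a ^ 2 := by
        gcongr with i; exact hx i
    _ = d * a ^ 2 := by simp
    _ ≤ (d * d) * a ^ 2 := by
        gcongr
        exact_mod_cast Nat.le_mul_self d
    _ = _ := by ring

theorem norm_le_of_mem_unitCube {d : ℕ} {x : E d} (hx : x ∈ unitCube d) : ‖x‖ ≤ d := by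
  have := norm_le_of_abs_le (a := 1) fun i => abs_le.2 ⟨by linarith [(hx i).1], (hx i).2⟩
  rwa [mul_one] at this

theorem integrable_of_abs_le_one_of_support {Ω : Type*} [MeasurableSpace Ω] {P : Measure Ω}
    {K : Ω → ℝ} (hK : Measurable K) (hb : ∀ p, |K p| ≤ 1) {S : Set Ω} (hS : P S ≠ ∞)
    (hs : ∀ p, p ∉ S → K p = 0) : Integrable K P := by
  have h1 : IntegrableOn K S P :=
    Measure.integrableOn_of_bounded (M := 1) hS hK.aestronglyMeasurable (ae_of_all _ hb)
  rwa [integrableOn_iff_integrable_of_support_subset] at h1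
  intro p hp
  by_contra h
  exact hp (hs p h)

theorem IsUnitBounded.integrable {d : ℕ} {f : E d → ℝ} (hf : IsUnitBounded f) : Integrable f :=
  integrable_of_abs_le_one_of_support hf.measurable hf.abs_le (by rw [volume_unitCube]; simp)
    hf.eq_zero

theorem IsUnitBounded.integral_abs_le {d : ℕ} {f g : E d → ℝ} (hf : IsUnitBounded f)
    (hg : ∀ x, |g x| ≤ 1) : |∫ x, f x * g x| ≤ 1 := by
  have h1 : ∫ x in unitCube d, f x * g x = ∫ x, f x * g x :=
    setIntegral_eq_integral_of_forall_compl_eq_zero fun x hx => by rw [hf.eq_zero x hx, zero_mul]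
  have h2 := norm_setIntegral_le_of_norm_le_const (μ := volume) (s := unitCube d)
    (f := fun x => f x * g x) (C := 1) (by rw [volume_unitCube]; simp) (fun x _ => by
      rw [norm_mul]; exact mul_le_one₀ (hf.abs_le x) (norm_nonneg _) (hg x))
  rw [h1, one_mul, Measure.real, volume_unitCube] at h2
  simpa using h2

theorem IsUnitBounded.abs_corr_le {d : ℕ} {f : E d → ℝ} (hf : IsUnitBounded f) (y : E d) :
    |corr f y| ≤ 1 :=
  hf.integral_abs_le fun _ => hf.abs_le _

/-- The autocorrelation is the L² inner product of f with its translate, and translation is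
continuous in L². -/
theorem IsUnitBounded.continuous_corr {d : ℕ} {f : E d → ℝ} (hf : IsUnitBounded f) :
    Continuous (corr f) := by
  have h2 : MemLp f 2 := by
    refine (memLp_two_iff_integrable_sq hf.measurable.aestronglyMeasurable).2 ?_
    refine IsUnitBounded.integrable ⟨hf.measurable.pow_const 2, fun x => ?_, fun x hx => ?_⟩
    · rw [abs_pow]; exact pow_le_one₀ (abs_nonneg _) (hf.abs_le x)
    · rw [hf.eq_zero x hx]; simp
  let g : C(E d, C(E d, E d)) :=
    ContinuousMap.curry ⟨fun p : E d × E d => p.2 - p.1, by fun_prop⟩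
  have hg : ∀ y, MeasurePreserving (g y) := fun y => measurePreserving_sub_right volume y
  have hc : Continuous fun y => Lp.compMeasurePreserving (g y) (hg y) h2.toLp :=
    continuous_const.compMeasurePreservingLp g.continuous hg (by simp)
  have heq : corr f = fun y => inner ℝ h2.toLp (Lp.compMeasurePreserving (g y) (hg y) h2.toLp) := by
    ext y
    rw [L2.inner_def, corr]
    refine integral_congr_ae ?_
    filter_upwards [h2.coeFn_toLp, Lp.coeFn_compMeasurePreserving h2.toLp (hg y),
      (hg y).quasiMeasurePreserving.ae h2.coeFn_toLp] with x h3 h4 h5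
    rw [h3, h4, Function.comp_apply, h5]
    simp [g, mul_comm]
  rw [heq]
  fun_prop

theorem integral_sub_mul_sub {d : ℕ} (f : E d → ℝ) (a b : E d) :
    ∫ x, f (x - a) * f (x - b) = corr f (b - a) := by
  rw [corr, ← integral_sub_right_eq_self (fun x => f x * f (x - (b - a))) a]
  congr 1
  ext x
  congr 2
  abel

theorem sq_integral_le {Ω : Type*} [MeasurableSpace Ω] {P : Measure Ω} [IsProbabilityMeasure P]
    {X : Ω → ℝ} (hX : MemLp X 2 P) : (∫ x, X x ∂P) ^ 2 ≤ ∫ x, X x ^ 2 ∂P := by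
  have h := ProbabilityTheory.variance_nonneg X P
  rw [ProbabilityTheory.variance_eq_sub hX] at h
  simpa using h

theorem IsUnitBounded.integrable_comp_sub {d : ℕ} {f : E d → ℝ} (hf : IsUnitBounded f)
    {Ω : Type*} [MeasurableSpace Ω] {P : Measure Ω} [IsProbabilityMeasure P] {z : Ω → E d}
    (hz : Measurable z) : Integrable (fun p : E d × Ω => f (p.1 - z p.2)) (volume.prod P) := by
  refine (integrable_prod_iff' (hf.measurable.comp (by fun_prop)).aestronglyMeasurable).2
    ⟨ae_of_all _ fun q => hf.integrable.comp_sub_right (z q), ?_⟩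
  have hc : ∀ q, ∫ x, ‖f (x - z q)‖ = ∫ x, ‖f x‖ := fun q =>
    integral_sub_right_eq_self (fun x => ‖f x‖) (z q)
  exact (integrable_const (∫ x, ‖f x‖)).congr (ae_of_all _ fun q => (hc q).symm)

/-- With g = f * κ, averaging over differences of two independent κ-points gives the autocorrelation
of g at y. By 2ab ≤ a² + b² and translation invariance this is at most its value at 0. -/
theorem integral_corr_shift_le {d : ℕ} {f : E d → ℝ} (hf : IsUnitBounded f) {κ : Measure (E d)}
    [IsProbabilityMeasure κ] {ρ : ℝ} (hκ : ∀ᵐ z ∂κ, ‖z‖ ≤ ρ) (y : E d) :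
    ∫ q : E d × E d, corr f (y + (q.1 - q.2)) ∂(κ.prod κ) ≤ ∫ x, (∫ z, f (x - z) ∂κ) ^ 2 := by
  set g : E d → ℝ := fun x => ∫ z, f (x - z) ∂κ with hg
  have hm2 : Measurable fun p : E d × E d => f (p.1 - p.2) :=
    hf.measurable.comp (measurable_fst.sub measurable_snd)
  have hgm : Measurable g := hm2.stronglyMeasurable.integral_prod_right'.measurable
  have hg1 : ∀ x, |g x| ≤ 1 := fun x => by
    have := norm_integral_le_of_norm_le_const (μ := κ) (C := 1)
      (f := fun z => f (x - z)) (ae_of_all _ fun θ => hf.abs_le _)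
    simpa using this
  have hg0 : ∀ x, x ∉ Metric.closedBall (0 : E d) (d + ρ) → g x = 0 := fun x hx => by
    rw [mem_closedBall_zero_iff, not_le] at hx
    refine integral_eq_zero_of_ae ?_
    filter_upwards [hκ] with z hz
    refine hf.eq_zero _ fun hmem => ?_
    linarith [norm_le_of_mem_unitCube hmem, norm_sub_norm_le x z]
  have hgint : Integrable fun x => g x ^ 2 := by
    refine integrable_of_abs_le_one_of_support (hgm.pow_const 2) ?_
      (measure_closedBall_lt_top (x := (0 : E d)) (r := d + ρ)).ne ?_
    · intro p
      rw [abs_pow]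
      exact pow_le_one₀ (abs_nonneg _) (hg1 p)
    · intro x hx
      rw [hg0 x hx]; ring
  have hgyint : Integrable fun x => g (x - y) ^ 2 := hgint.comp_sub_right y
  have hprod : Integrable fun x => g x * g (x - y) := by
    refine (hgint.add hgyint).mono'
      (hgm.mul (hgm.comp (measurable_sub_const y))).aestronglyMeasurable (ae_of_all _ fun x => ?_)
    simp only [Pi.add_apply]
    rw [Real.norm_eq_abs, abs_le]
    constructor <;> nlinarith [sq_nonneg (g x + g (x - y)), sq_nonneg (g x - g (x - y)),
      sq_nonneg (g x), sq_nonneg (g (x - y))]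
  have hkey : ∫ q : E d × E d, corr f (y + (q.1 - q.2)) ∂(κ.prod κ) = ∫ x, g x * g (x - y) := by
    have h1 : ∀ x, g x * g (x - y) =
        ∫ q : E d × E d, f (x - q.2) * f (x - (y + q.1)) ∂(κ.prod κ) := fun x => by
      rw [mul_comm, hg]
      simp only [sub_sub]
      rw [← integral_prod_mul]
      simp only [mul_comm]
    simp_rw [h1]
    rw [integral_integral_swap]
    · refine integral_congr_ae (ae_of_all _ fun q => ?_)
      simp only
      rw [integral_sub_mul_sub, add_sub_assoc]
    · have hm3 : Measurable fun p : E d × (E d × E d) =>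
          f (p.1 - p.2.2) * f (p.1 - (y + p.2.1)) := by
        refine (hf.measurable.comp ?_).mul (hf.measurable.comp ?_) <;> fun_prop
      have hi := hf.integrable_comp_sub (P := κ.prod κ) (measurable_snd (α := E d) (β := E d))
      refine hi.mono hm3.aestronglyMeasurable (ae_of_all _ fun p => ?_)
      rw [Function.uncurry, norm_mul]
      exact mul_le_of_le_one_right (norm_nonneg _) (hf.abs_le _)
  rw [hkey]
  calc ∫ x, g x * g (x - y) ≤ ∫ x, (1 / 2) * (g x ^ 2 + g (x - y) ^ 2) := by
        refine integral_mono hprod ((hgint.add hgyint).const_mul _) fun x => ?_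
        simp only
        nlinarith [sq_nonneg (g x - g (x - y))]
    _ = ∫ x, g x ^ 2 := by
        rw [integral_const_mul, integral_add hgint hgyint,
          integral_sub_right_eq_self (fun x => g x ^ 2) y]
        ring

/-- Any shift h = z - z' with z, z' in the support of κ may be inserted at the cost of the chord
regularity error, as ‖h‖ ≤ 2ρ. The left side does not depend on h, so averaging over z and z'
smooths the autocorrelation by κ. -/
theorem integral_corr_chord_le {d : ℕ} (hd : 2 ≤ d) {f : E d → ℝ} (hf : IsUnitBounded f)
    {κ : Measure (E d)} [IsProbabilityMeasure κ] {ρ : ℝ} (hκ : ∀ᵐ z ∂κ, ‖z‖ ≤ ρ)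
    {b : ℝ} (hb : 0 < b) {y : ℝ → E d} (hy : Continuous y)
    (hyb : ∀ θ θ', ‖y θ - y θ'‖ = |b * Real.sin ((θ - θ') / 2)|) :
    ∫ p : ℝ × ℝ, (∫ U, corr f (rot U (y p.2 - y p.1)) ∂haarSO d) ∂(angleMeasure.prod angleMeasure)
      ≤ (∫ x, (∫ z, f (x - z) ∂κ) ^ 2) + chordConst d * √(2 * ρ / b) := by
  set ν := angleMeasure with hν
  have hFc := hf.continuous_corr
  set F := corr f with hF
  have hF1 : ∀ x, |F x| ≤ 1 := hf.abs_corr_le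
  set C := chordConst d * √(2 * ρ / b) with hC
  set Y : ℝ × ℝ → E d := fun p => y p.2 - y p.1 with hYdef
  have hYc : Continuous Y := by fun_prop
  have hcont : ∀ h : E d, Continuous fun p : (ℝ × ℝ) × SO d => F (rot p.2 (Y p.1) + h) := fun h =>
    hFc.comp ((continuous_rot.comp
      (by fun_prop : Continuous fun p : (ℝ × ℝ) × SO d => (p.2, Y p.1))).add continuous_const)
  have hint : ∀ h : E d, Integrable (fun p : (ℝ × ℝ) × SO d => F (rot p.2 (Y p.1) + h))
      ((ν.prod ν).prod (haarSO d)) := fun h =>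
    Integrable.of_bound (hcont h).aestronglyMeasurable 1 (ae_of_all _ fun p => hF1 _)
  have hshift : ∀ h : E d, ‖h‖ ≤ 2 * ρ →
      ∫ p : ℝ × ℝ, (∫ U, F (rot U (Y p)) ∂haarSO d) ∂(ν.prod ν) ≤
        (∫ p, F (rot p.2 (Y p.1) + h) ∂((ν.prod ν).prod (haarSO d))) + C := by
    intro h hh
    have h0 := hint 0
    simp only [add_zero] at h0
    have hD : ∀ p : ℝ × ℝ, ∫ U, (F (rot U (Y p)) - F (rot U (Y p) + h)) ∂haarSO d =
        (∫ U, F (rot U (Y p)) ∂haarSO d) - ∫ U, F (rot U (Y p) + h) ∂haarSO d := fun p =>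
      integral_sub
        (integrable_haarSO_of_continuous (hFc.comp (continuous_rot_left _)))
        (integrable_haarSO_of_continuous (hFc.comp ((continuous_rot_left _).add continuous_const)))
    have hDint : Integrable (fun p : ℝ × ℝ =>
        ∫ U, (F (rot U (Y p)) - F (rot U (Y p) + h)) ∂haarSO d) (ν.prod ν) :=
      (h0.sub (hint h)).integral_prod_left
    have h1 : ∫ p : ℝ × ℝ, (∫ U, (F (rot U (Y p)) - F (rot U (Y p) + h)) ∂haarSO d) ∂(ν.prod ν)
        ≤ C := by
      rw [integral_prod _ hDint]
      have hle : ∀ᵐ θ' ∂ν, ∫ θ, (∫ U, (F (rot U (Y (θ', θ))) -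
          F (rot U (Y (θ', θ)) + h)) ∂haarSO d) ∂ν ≤ C := by
        filter_upwards [ae_angleMeasure] with θ' hθ'
        refine (le_abs_self _).trans ((abs_integral_chord_shift_le hd hFc hF1 h hb hθ'
          (w := fun θ => Y (θ', θ)) fun θ => hyb θ θ').trans ?_)
        have := chordConst_pos d
        rw [hC]
        gcongr
      refine (integral_mono_ae hDint.integral_prod_left (integrable_const C) hle).trans ?_
      simp
    rw [integral_prod _ (hint h)]
    simp_rw [hD] at h1
    rw [integral_sub h0.integral_prod_left (hint h).integral_prod_left] at h1
    linarith
  have hcont4 : Continuous fun r : (E d × E d) × ((ℝ × ℝ) × SO d) =>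
      F (rot r.2.2 (Y r.2.1) + (r.1.1 - r.1.2)) := by
    refine hFc.comp ((continuous_rot.comp
      (by fun_prop : Continuous fun r : (E d × E d) × ((ℝ × ℝ) × SO d) =>
        (r.2.2, Y r.2.1))).add (by fun_prop))
  have hint4 : Integrable (fun r : (E d × E d) × ((ℝ × ℝ) × SO d) =>
      F (rot r.2.2 (Y r.2.1) + (r.1.1 - r.1.2)))
      ((κ.prod κ).prod ((ν.prod ν).prod (haarSO d))) :=
    Integrable.of_bound hcont4.aestronglyMeasurable 1 (ae_of_all _ fun p => hF1 _)
  have hq : ∀ᵐ q : E d × E d ∂(κ.prod κ), ‖q.1 - q.2‖ ≤ 2 * ρ := by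
    have h1 : ∀ᵐ q : E d × E d ∂(κ.prod κ), ‖q.1‖ ≤ ρ :=
      Measure.quasiMeasurePreserving_fst.ae hκ
    have h2 : ∀ᵐ q : E d × E d ∂(κ.prod κ), ‖q.2‖ ≤ ρ :=
      Measure.quasiMeasurePreserving_snd.ae hκ
    filter_upwards [h1, h2] with q h3 h4
    linarith [norm_sub_le q.1 q.2]
  calc ∫ p : ℝ × ℝ, (∫ U, F (rot U (Y p)) ∂haarSO d) ∂(ν.prod ν)
      = ∫ _q : E d × E d, (∫ p : ℝ × ℝ, (∫ U, F (rot U (Y p)) ∂haarSO d) ∂(ν.prod ν))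
          ∂(κ.prod κ) := by simp
    _ ≤ ∫ q : E d × E d, ((∫ p, F (rot p.2 (Y p.1) + (q.1 - q.2))
          ∂((ν.prod ν).prod (haarSO d))) + C) ∂(κ.prod κ) := by
        refine integral_mono_ae (integrable_const _)
          (hint4.integral_prod_left.add (integrable_const C)) ?_
        filter_upwards [hq] with q hq
        exact hshift _ hq
    _ = (∫ p, (∫ q : E d × E d, F (rot p.2 (Y p.1) + (q.1 - q.2)) ∂(κ.prod κ))
          ∂((ν.prod ν).prod (haarSO d))) + C := by
        rw [integral_add hint4.integral_prod_left (integrable_const C),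
          integral_integral_swap hint4]
        simp
    _ ≤ (∫ _p : (ℝ × ℝ) × SO d, (∫ x, (∫ z, f (x - z) ∂κ) ^ 2)
          ∂((ν.prod ν).prod (haarSO d))) + C := by
        refine add_le_add (integral_mono hint4.integral_prod_right (integrable_const _) ?_) le_rfl
        intro p
        exact integral_corr_shift_le hf hκ _
    _ = _ := by simp

/-- Φ is invariant under U ↦ U H_θ, so the average over θ falls on f alone. Cauchy-Schwarz then
discards Φ, and expanding the square of the θ-average produces autocorrelations at rotated chords.
-/
theorem sq_integral_le_integral_corr {d : ℕ} {f : E d → ℝ} (hf : IsUnitBounded f)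
    {Φ : E d → SO d → ℝ} (hΦ : Measurable (Function.uncurry Φ)) (hΦ1 : ∀ x U, |Φ x U| ≤ 1)
    (hΦ0 : ∀ x, x ∉ unitCube d → ∀ U, Φ x U = 0) {H : ℝ → SO d}
    (hΦH : ∀ x U θ, Φ x (U * H θ) = Φ x U) {y : E d} (hy : Continuous fun θ => rot (H θ) y) :
    (∫ x, ∫ U, Φ x U * f (x - rot U y) ∂haarSO d) ^ 2 ≤
      ∫ p : ℝ × ℝ, (∫ U, corr f (rot U (rot (H p.2) y - rot (H p.1) y)) ∂haarSO d)
        ∂(angleMeasure.prod angleMeasure) := by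
  set ν := angleMeasure with hν
  set Y : ℝ → E d := fun θ => rot (H θ) y with hY
  have hYn : ∀ θ, ‖Y θ‖ = ‖y‖ := fun θ => norm_rot _ _
  have hmeas : Measurable fun p : (E d × SO d) × ℝ => f (p.1.1 - rot p.1.2 (Y p.2)) := by
    refine hf.measurable.comp ?_
    have h1 : Continuous fun p : (E d × SO d) × ℝ => rot p.1.2 (Y p.2) :=
      continuous_rot.comp (by fun_prop : Continuous fun p : (E d × SO d) × ℝ => (p.1.2, Y p.2))
    fun_prop
  set g : E d × SO d → ℝ := fun p => ∫ θ, f (p.1 - rot p.2 (Y θ)) ∂ν with hg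
  have hgm : Measurable g := hmeas.stronglyMeasurable.integral_prod_right'.measurable
  have hg1 : ∀ p, |g p| ≤ 1 := fun p => by
    have := norm_integral_le_of_norm_le_const (μ := ν) (C := 1)
      (f := fun θ => f (p.1 - rot p.2 (Y θ))) (ae_of_all _ fun θ => hf.abs_le _)
    simpa using this
  have hfar : ∀ (x : E d) (U : SO d) (θ : ℝ), d + ‖y‖ < ‖x‖ → f (x - rot U (Y θ)) = 0 := by
    intro x U θ hx
    refine hf.eq_zero _ fun hmem => ?_
    have h1 := norm_le_of_mem_unitCube hmem
    have h2 := norm_sub_norm_le x (rot U (Y θ))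
    rw [norm_rot, hYn] at h2
    linarith
  set B : Set (E d × SO d) := Metric.closedBall 0 (d + ‖y‖) ×ˢ univ with hBdef
  have hBfin : (volume.prod (haarSO d)) B ≠ ∞ := by
    rw [hBdef, Measure.prod_prod]
    exact (ENNReal.mul_lt_top measure_closedBall_lt_top (by simp)).ne
  have hB : ∀ {p : E d × SO d}, p ∉ B → d + ‖y‖ < ‖p.1‖ := fun {p} hp => by
    by_contra h
    exact hp ⟨mem_closedBall_zero_iff.2 (not_lt.1 h), mem_univ _⟩
  have hJ : ∫ x, ∫ U, Φ x U * f (x - rot U y) ∂haarSO d =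
      ∫ p, Φ p.1 p.2 * g p ∂(volume.prod (haarSO d)) := by
    have hθ : ∀ θ, ∫ x, ∫ U, Φ x U * f (x - rot U y) ∂haarSO d =
        ∫ p, Φ p.1 p.2 * f (p.1 - rot p.2 (Y θ)) ∂(volume.prod (haarSO d)) := by
      intro θ
      rw [integral_prod]
      · refine integral_congr_ae (ae_of_all _ fun x => ?_)
        simp only
        -- Right invariance: U is replaced by U H_θ, which leaves Φ unchanged.
        rw [← integral_mul_right_eq_self (fun U => Φ x U * f (x - rot U y)) (H θ)]
        simp only [hΦH, rot_mul, hY]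
      · refine integrable_of_abs_le_one_of_support ?_ ?_ hBfin ?_
        · exact hΦ.mul (hmeas.comp (measurable_id.prodMk measurable_const))
        · intro p
          rw [abs_mul]
          exact mul_le_one₀ (hΦ1 _ _) (abs_nonneg _) (hf.abs_le _)
        · intro p hp
          rw [hfar _ _ _ (hB hp), mul_zero]
    have hconst : ∫ x, ∫ U, Φ x U * f (x - rot U y) ∂haarSO d =
        ∫ θ, (∫ p, Φ p.1 p.2 * f (p.1 - rot p.2 (Y θ)) ∂(volume.prod (haarSO d))) ∂ν := by
      simp_rw [← hθ]; simp
    rw [hconst, integral_integral_swap]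
    · simp only [hg, integral_const_mul]
    · refine integrable_of_abs_le_one_of_support (S := univ ×ˢ B) ?_ ?_ ?_ ?_
      · exact (hΦ.comp measurable_snd).mul (hmeas.comp measurable_swap)
      · intro p
        rw [Function.uncurry, abs_mul]
        exact mul_le_one₀ (hΦ1 _ _) (abs_nonneg _) (hf.abs_le _)
      · rw [Measure.prod_prod]
        exact ENNReal.mul_ne_top (by simp) hBfin
      · intro p hp
        rw [Function.uncurry, hfar _ _ _ (hB fun h => hp ⟨mem_univ _, h⟩), mul_zero]
  have hgint : Integrable (fun p => g p ^ 2) (volume.prod (haarSO d)) := by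
    refine integrable_of_abs_le_one_of_support (hgm.pow_const 2) ?_ hBfin ?_
    · intro p
      rw [abs_pow]
      exact pow_le_one₀ (abs_nonneg _) (hg1 p)
    · intro p hp
      have : g p = 0 := by
        simp only [hg, hfar _ _ _ (hB hp), integral_zero]
      rw [this]; ring
  have hgsq : ∫ p, g p ^ 2 ∂(volume.prod (haarSO d)) =
      ∫ q : ℝ × ℝ, (∫ U, corr f (rot U (Y q.2 - Y q.1)) ∂haarSO d) ∂(ν.prod ν) := by
    have h1 : ∀ p, g p ^ 2 = ∫ q : ℝ × ℝ,
        f (p.1 - rot p.2 (Y q.1)) * f (p.1 - rot p.2 (Y q.2)) ∂(ν.prod ν) := fun p => by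
      rw [sq, hg]
      exact (integral_prod_mul _ _).symm
    have hm1 : Measurable fun p : (E d × SO d) × (ℝ × ℝ) =>
        f (p.1.1 - rot p.1.2 (Y p.2.1)) * f (p.1.1 - rot p.1.2 (Y p.2.2)) :=
      (hmeas.comp (measurable_fst.prodMk (measurable_fst.comp measurable_snd))).mul
        (hmeas.comp (measurable_fst.prodMk (measurable_snd.comp measurable_snd)))
    have hb1 : ∀ p : (E d × SO d) × (ℝ × ℝ),
        |f (p.1.1 - rot p.1.2 (Y p.2.1)) * f (p.1.1 - rot p.1.2 (Y p.2.2))| ≤ 1 := fun p => by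
      rw [abs_mul]
      exact mul_le_one₀ (hf.abs_le _) (abs_nonneg _) (hf.abs_le _)
    simp_rw [h1]
    rw [integral_integral_swap]
    · refine integral_congr_ae (ae_of_all _ fun q => ?_)
      simp only
      rw [integral_prod_symm]
      · refine integral_congr_ae (ae_of_all _ fun U => ?_)
        simp only
        rw [integral_sub_mul_sub, rot_sub]
      · refine integrable_of_abs_le_one_of_support
          (hm1.comp (measurable_id.prodMk measurable_const)) (fun p => hb1 (p, q)) hBfin ?_
        intro p hp
        simp [hfar _ _ _ (hB hp)]
    · refine integrable_of_abs_le_one_of_support (S := B ×ˢ univ) hm1 hb1 ?_ ?_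
      · rw [Measure.prod_prod]
        exact ENNReal.mul_ne_top hBfin (by simp)
      · intro p hp
        simp [Function.uncurry, hfar _ _ _ (hB fun h => hp ⟨h, mem_univ _⟩)]
  rw [hJ, ← hgsq]
  -- Φ vanishes off this set of total mass one, so Cauchy-Schwarz takes the form of nonnegativity of
  -- a variance.
  set S : Set (E d × SO d) := unitCube d ×ˢ univ with hS
  have hSprob : IsProbabilityMeasure ((volume.prod (haarSO d)).restrict S) := ⟨by
    rw [Measure.restrict_apply_univ, hS, Measure.prod_prod, volume_unitCube, measure_univ, one_mul]⟩
  have hX1 : ∀ p : E d × SO d, ‖Φ p.1 p.2 * g p‖ ≤ 1 := fun p => by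
    rw [norm_mul]
    exact mul_le_one₀ (hΦ1 _ _) (norm_nonneg _) (hg1 _)
  have hXm : Measurable fun p : E d × SO d => Φ p.1 p.2 * g p := hΦ.mul hgm
  have hres : ∫ p in S, Φ p.1 p.2 * g p ∂(volume.prod (haarSO d)) =
      ∫ p, Φ p.1 p.2 * g p ∂(volume.prod (haarSO d)) :=
    setIntegral_eq_integral_of_forall_compl_eq_zero fun p hp => by
      rw [hΦ0 p.1 (fun h => hp ⟨h, mem_univ _⟩), zero_mul]
  rw [← hres]
  have hL2 : MemLp (fun p : E d × SO d => Φ p.1 p.2 * g p) 2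
      ((volume.prod (haarSO d)).restrict S) :=
    MemLp.of_bound hXm.aestronglyMeasurable 1 (ae_of_all _ hX1)
  refine (sq_integral_le hL2).trans ?_
  refine le_trans ?_ (setIntegral_le_integral (s := S) hgint (ae_of_all _ fun p => sq_nonneg _))
  refine integral_mono hL2.integrable_sq hgint.integrableOn fun p => ?_
  simp only
  rw [mul_pow]
  exact mul_le_of_le_one_left (sq_nonneg _) ((sq_le_one_iff_abs_le_one _).2 (hΦ1 _ _))

/-! ### The generalized von Neumann inequality -/

theorem simplexWidth_pos {d k : ℕ} (hk : 1 ≤ k) {v : Fin k → E d} (hv : LinearIndependent ℝ v) :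
    0 < simplexWidth v := by
  have : Nonempty (Fin k) := ⟨⟨0, hk⟩⟩
  obtain ⟨j, hj⟩ := exists_eq_ciInf_of_finite
    (f := fun j : Fin k => Metric.infDist (v j) (Submodule.span ℝ (v '' {j}ᶜ) : Set (E d)))
  rw [simplexWidth, ← hj, ← IsClosed.notMem_iff_infDist_pos
    (Submodule.closed_of_finiteDimensional _) ⟨0, Submodule.zero_mem _⟩]
  exact hv.notMem_span_image (by simp)

theorem simplexWidth_le {d k : ℕ} (v : Fin k → E d) (j : Fin k) :
    simplexWidth v ≤ Metric.infDist (v j) (Submodule.span ℝ (v '' {j}ᶜ) : Set (E d)) :=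
  ciInf_le (Set.finite_range _).bddBelow j

theorem norm_cos_sin_sub {d : ℕ} {e e' : E d} (he : ‖e‖ = 1) (he' : ‖e'‖ = 1)
    (hee : inner ℝ e e' = 0) (r θ θ' : ℝ) :
    ‖(r * (Real.cos θ - Real.cos θ')) • e + (r * (Real.sin θ - Real.sin θ')) • e'‖ =
      |2 * r * Real.sin ((θ - θ') / 2)| := by
  rw [← abs_norm, ← sq_eq_sq_iff_abs_eq_abs, ← real_inner_self_eq_norm_sq]
  have hee' : inner ℝ e' e = 0 := by rw [real_inner_comm, hee]
  simp only [inner_add_right, inner_smul_right, inner_add_left, inner_smul_left,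
    real_inner_self_eq_norm_sq, he, he', hee, hee', conj_trivial]
  have h1 := Real.cos_sub θ θ'
  have h2 : Real.cos (θ - θ') = 1 - 2 * Real.sin ((θ - θ') / 2) ^ 2 := by
    have h3 := Real.cos_two_mul ((θ - θ') / 2)
    rw [mul_div_cancel₀ _ (two_ne_zero' ℝ)] at h3
    linarith [Real.sin_sq_add_cos_sq ((θ - θ') / 2)]
  rw [h2] at h1
  linear_combination r ^ 2 * (Real.sin_sq_add_cos_sq θ + Real.sin_sq_add_cos_sq θ') + 2 * r ^ 2 * h1

/-- The generalized von Neumann inequality. Only the factor G_j feels the rotations H_θ in the plane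
of e and e', so all other factors can be absorbed into Φ and discarded. -/
theorem sq_simplexForm_le {d k : ℕ} (hk : 1 ≤ k) (hd : k + 1 ≤ d) {v : Fin k → E d}
    (hv : LinearIndependent ℝ v) {l : ℝ} (hl : 0 < l) {f : E d → ℝ} (hf : IsUnitBounded f)
    {G : Fin k → E d → ℝ} (hGm : ∀ i, Measurable (G i)) (hG1 : ∀ i x, |G i x| ≤ 1)
    {j : Fin k} (hGj : IsUnitBounded (G j)) {κ : Measure (E d)} [IsProbabilityMeasure κ] {ρ : ℝ}
    (hρ : 0 ≤ ρ) (hκ : ∀ᵐ z ∂κ, ‖z‖ ≤ ρ) :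
    (∫ x, ∫ U, f x * ∏ i, G i (x - l • rot U (v i)) ∂haarSO d) ^ 2 ≤
      (∫ x, (∫ z, G j (x - z) ∂κ) ^ 2) + chordConst d * √(ρ / (l * simplexWidth v)) := by
  set c := simplexWidth v with hc
  have hcpos : 0 < c := simplexWidth_pos hk hv
  set S := Submodule.span ℝ (v '' {j}ᶜ) with hS
  set w := v j - S.starProjection (v j) with hw
  have hwS : w ∈ Sᗮ := Submodule.sub_starProjection_mem_orthogonal (v j)
  set r := ‖w‖ with hr
  have hcr : c ≤ r := (simplexWidth_le v j).trans
    ((Metric.infDist_le_dist_of_mem (Submodule.starProjection_apply_mem S (v j))).trans_eq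
      (dist_eq_norm _ _))
  have hrpos : 0 < r := hcpos.trans_le hcr
  have hw0 : w ≠ 0 := norm_pos_iff.1 hrpos
  set e := r⁻¹ • w with he_def
  have he : ‖e‖ = 1 := norm_smul_inv_norm hw0
  have hfin : Module.finrank ℝ (Submodule.span ℝ (range v)) ≤ k := by
    have h := finrank_range_le_card (R := ℝ) v
    rwa [Fintype.card_fin] at h
  -- The extra dimension d ≥ k + 1 is used here.
  obtain ⟨e', he', hev⟩ := exists_unit_orthogonal (Submodule.span ℝ (range v)) (by omega)
  have hSle : S ≤ Submodule.span ℝ (range v) := Submodule.span_mono (image_subset_range _ _)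
  have hwv : w ∈ Submodule.span ℝ (range v) :=
    Submodule.sub_mem _ (Submodule.subset_span (mem_range_self j))
      (hSle (Submodule.starProjection_apply_mem S (v j)))
  have hee : inner ℝ e e' = 0 := by
    rw [he_def, inner_smul_left, real_inner_comm, hev w hwv, mul_zero]
  have hei : ∀ i, i ≠ j → inner ℝ e (v i) = 0 := fun i hi => by
    have hi' : v i ∈ S := Submodule.subset_span (mem_image_of_mem v hi)
    rw [he_def, inner_smul_left, Submodule.inner_left_of_mem_orthogonal hi' hwS, mul_zero]
  have hej : inner ℝ e (v j) = r := by
    have h1 : v j = w + S.starProjection (v j) := by rw [hw]; abel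
    rw [h1, inner_add_right, he_def, inner_smul_left, inner_smul_left,
      Submodule.inner_left_of_mem_orthogonal (Submodule.starProjection_apply_mem S (v j)) hwS,
      real_inner_self_eq_norm_sq, ← hr, conj_trivial]
    field_simp
    ring
  have he'i : ∀ i, inner ℝ e' (v i) = 0 := fun i => hev _ (Submodule.subset_span (mem_range_self i))
  choose H hH using fun θ => exists_rot_eq_planeRotation he he' hee θ
  have hHi : ∀ θ i, i ≠ j → rot (H θ) (v i) = v i := fun θ i hi => by
    rw [hH, planeRotation_apply, hei i hi, he'i]; simp
  have hHj : ∀ θ, rot (H θ) (l • v j) =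
      l • v j + (l * r * (Real.cos θ - 1)) • e + (l * r * Real.sin θ) • e' := fun θ => by
    rw [rot_smul, hH, planeRotation_apply, hej, he'i]
    module
  have hcont : Continuous fun θ => rot (H θ) (l • v j) := by
    simp_rw [hHj]; fun_prop
  set Φ : E d → SO d → ℝ := fun x U => f x * ∏ i ∈ Finset.univ.erase j, G i (x - l • rot U (v i))
    with hΦ
  have hform : ∫ x, ∫ U, f x * ∏ i, G i (x - l • rot U (v i)) ∂haarSO d =
      ∫ x, ∫ U, Φ x U * G j (x - rot U (l • v j)) ∂haarSO d := by
    simp only [hΦ, rot_smul]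
    refine integral_congr_ae (ae_of_all _ fun x => integral_congr_ae (ae_of_all _ fun U => ?_))
    simp only
    rw [← Finset.prod_erase_mul _ _ (Finset.mem_univ j), mul_assoc]
  have hΦm : Measurable (Function.uncurry Φ) := by
    refine (hf.measurable.comp measurable_fst).mul (Finset.measurable_fun_prod _ fun i _ => ?_)
    refine (hGm i).comp (measurable_fst.sub ?_)
    exact (((continuous_rot_left (v i)).measurable).comp measurable_snd).const_smul l
  have h1 := sq_integral_le_integral_corr hGj hΦm
    (fun x U => by
      rw [hΦ, abs_mul, Finset.abs_prod]
      exact mul_le_one₀ (hf.abs_le x) (Finset.prod_nonneg fun _ _ => abs_nonneg _)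
        (Finset.prod_le_one (fun _ _ => abs_nonneg _) fun i _ => hG1 i _))
    (fun x hx U => by simp only [hΦ, hf.eq_zero x hx, zero_mul]) (H := H)
    (fun x U θ => by
      simp only [hΦ]
      congr 1
      refine Finset.prod_congr rfl fun i hi => ?_
      rw [rot_mul, hHi θ i (Finset.ne_of_mem_erase hi)]) (y := l • v j) hcont
  -- A circle of radius lr has chords 2lr |sin((θ - θ')/2)|.
  have h2 := integral_corr_chord_le (by omega) hGj hκ (b := 2 * (l * r)) (by positivity) hcont
    (fun θ θ' => by
      rw [← norm_cos_sin_sub he he' hee (l * r) θ θ', hHj, hHj]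
      congr 1
      module)
  rw [hform]
  refine (h1.trans h2).trans ?_
  have := chordConst_pos d
  -- The shifts of size 2ρ and the diameter 2lr share the factor 2; then r is bounded below by the
  -- width.
  rw [mul_div_mul_left _ _ two_ne_zero]
  gcongr

/-! ### Cubes -/

theorem cube_eq_preimage {d : ℕ} (t : E d) (L : ℝ) : cube t L =
    (WithLp.ofLp : E d → Fin d → ℝ) ⁻¹' Set.pi univ fun i => Icc (t i - L / 2) (t i + L / 2) := by
  ext x
  refine ⟨fun h i _ => ?_, fun h i => ?_⟩
  · have := abs_le.1 (h i)
    exact ⟨by linarith, by linarith⟩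
  · have := h i trivial
    exact abs_le.2 ⟨by linarith [this.1], by linarith [this.2]⟩

theorem measurableSet_cube {d : ℕ} (t : E d) (L : ℝ) : MeasurableSet (cube t L) := by
  rw [cube_eq_preimage]
  exact (PiLp.volume_preserving_ofLp (Fin d)).measurable
    (MeasurableSet.univ_pi fun _ => measurableSet_Icc)

theorem volume_cube {d : ℕ} (t : E d) (L : ℝ) : volume (cube t L) = ENNReal.ofReal L ^ d := by
  rw [cube_eq_preimage, volume_pi_preimage]
  simp

theorem volume_real_cube {d : ℕ} (t : E d) {L : ℝ} (hL : 0 ≤ L) :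
    volume.real (cube t L) = L ^ d := by
  rw [Measure.real, volume_cube, ENNReal.toReal_pow, ENNReal.toReal_ofReal hL]

theorem volume_cube_ne_top {d : ℕ} (t : E d) (L : ℝ) : volume (cube t L) ≠ ∞ := by
  rw [volume_cube]; simp

theorem volume_cube_pos {d : ℕ} (t : E d) {L : ℝ} (hL : 0 < L) : 0 < volume (cube t L) := by
  rw [volume_cube]
  exact ENNReal.pow_pos (ENNReal.ofReal_pos.2 hL) d

/-- The centre of the unit cube. -/
def cubeCenter (d : ℕ) : E d := WithLp.toLp 2 fun _ => 1 / 2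

theorem unitCube_eq_cube (d : ℕ) : unitCube d = cube (cubeCenter d) 1 := by
  ext x
  refine forall_congr' fun i => ?_
  simp only [cubeCenter, abs_le]
  constructor <;> rintro ⟨h1, h2⟩ <;> constructor <;> linarith

theorem cube_subset_cube {d : ℕ} (t : E d) {L M : ℝ} (h : L ≤ M) : cube t L ⊆ cube t M :=
  fun _ hx i => (hx i).trans (by linarith)

theorem norm_le_of_mem_cube {d : ℕ} {L : ℝ} {z : E d} (hz : z ∈ cube (0 : E d) L) :
    ‖z‖ ≤ d * (L / 2) :=
  norm_le_of_abs_le fun i => by simpa using hz i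

theorem pow_sub_pow_le {a b : ℝ} (hb : 0 ≤ b) (hab : b ≤ a) (d : ℕ) :
    a ^ d - b ^ d ≤ (a - b) * d * a ^ (d - 1) := by
  have h := (le_abs_self _).trans (abs_pow_sub_pow_le a b d)
  rwa [abs_of_nonneg (by linarith : 0 ≤ a - b), abs_of_nonneg hb,
    abs_of_nonneg (hb.trans hab), max_eq_left hab] at h

theorem volume_real_cube_diff_le {d : ℕ} (t : E d) {a b : ℝ} (hb : 0 ≤ b) (hab : b ≤ a) :
    volume.real (cube t a \ cube t b) ≤ (a - b) * d * a ^ (d - 1) := by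
  rw [measureReal_sdiff (cube_subset_cube t hab) (measurableSet_cube t b) (volume_cube_ne_top t a),
    volume_real_cube t hb, volume_real_cube t (hb.trans hab)]
  exact pow_sub_pow_le hb hab d

/-- The uniform probability measure on the cube of side `L` centred at the origin. -/
def cubeMeasure (d : ℕ) (L : ℝ) : Measure (E d) := ProbabilityTheory.cond volume (cube (0 : E d) L)

theorem isProbabilityMeasure_cubeMeasure (d : ℕ) {L : ℝ} (hL : 0 < L) :
    IsProbabilityMeasure (cubeMeasure d L) :=
  ProbabilityTheory.cond_isProbabilityMeasure_of_finite (volume_cube_pos 0 hL).ne'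
    (volume_cube_ne_top 0 L)

theorem ae_cubeMeasure (d : ℕ) (L : ℝ) : ∀ᵐ z ∂(cubeMeasure d L), ‖z‖ ≤ d * (L / 2) := by
  have h : ∀ᵐ z ∂(cubeMeasure d L), z ∈ cube (0 : E d) L :=
    ProbabilityTheory.ae_cond_mem (measurableSet_cube 0 L)
  filter_upwards [h] with z hz using norm_le_of_mem_cube hz

theorem integral_cubeMeasure_indicator {d : ℕ} {A : Set (E d)} (hA : MeasurableSet A) (L : ℝ)
    (x : E d) :
    ∫ z, A.indicator (fun _ => (1 : ℝ)) (x - z) ∂(cubeMeasure d L) =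
      volume.real (A ∩ cube x L) / volume.real (cube (0 : E d) L) := by
  have hmp : MeasurePreserving (fun z : E d => x - z) := Measure.measurePreserving_sub_left volume x
  have hS : MeasurableSet ((fun z : E d => x - z) ⁻¹' A) := hmp.measurable hA
  have h1 : (fun z => A.indicator (fun _ => (1 : ℝ)) (x - z)) =
      ((fun z : E d => x - z) ⁻¹' A).indicator fun _ => (1 : ℝ) := by
    ext z; rfl
  have h2 : cube (0 : E d) L ∩ (fun z : E d => x - z) ⁻¹' A =
      (fun z : E d => x - z) ⁻¹' (A ∩ cube x L) := by
    ext z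
    simp [cube, and_comm]
  rw [h1, integral_indicator_const _ hS, smul_eq_mul, mul_one, Measure.real, cubeMeasure,
    ProbabilityTheory.cond_apply (measurableSet_cube 0 L), h2,
    hmp.measure_preimage (hA.inter (measurableSet_cube x L)).nullMeasurableSet, ENNReal.toReal_mul,
    ENNReal.toReal_inv, div_eq_inv_mul]
  rfl

/-- The balanced function `1_A - |A| 1_{[0,1]^d}`. -/
def balanced {d : ℕ} (A : Set (E d)) (x : E d) : ℝ :=
  A.indicator (fun _ => (1 : ℝ)) x - volume.real A * (unitCube d).indicator (fun _ => (1 : ℝ)) x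

theorem indicator_one_mem_Icc {d : ℕ} (A : Set (E d)) (x : E d) :
    0 ≤ A.indicator (fun _ => (1 : ℝ)) x ∧ A.indicator (fun _ => (1 : ℝ)) x ≤ 1 := by
  by_cases h : x ∈ A <;> simp [h]

theorem volume_real_le_one {d : ℕ} {A : Set (E d)} (hA : A ⊆ unitCube d) : volume.real A ≤ 1 := by
  have := measureReal_mono hA (by rw [volume_unitCube]; simp)
  rwa [measureReal_def (s := unitCube d), volume_unitCube, ENNReal.toReal_one] at this

theorem isUnitBounded_indicator {d : ℕ} {A : Set (E d)} (hA : MeasurableSet A)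
    (hAQ : A ⊆ unitCube d) : IsUnitBounded (A.indicator fun _ => (1 : ℝ)) where
  measurable := measurable_const.indicator hA
  abs_le x := by
    have := indicator_one_mem_Icc A x
    rw [abs_of_nonneg this.1]; exact this.2
  eq_zero x hx := indicator_of_notMem (fun h => hx (hAQ h)) _

theorem isUnitBounded_balanced {d : ℕ} {A : Set (E d)} (hA : MeasurableSet A)
    (hAQ : A ⊆ unitCube d) : IsUnitBounded (balanced A) where
  measurable := (measurable_const.indicator hA).sub
    ((measurable_const.indicator (measurableSet_unitCube d)).const_mul _)
  abs_le x := by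
    have h1 := indicator_one_mem_Icc A x
    have h2 := indicator_one_mem_Icc (unitCube d) x
    have h3 := volume_real_le_one hAQ
    have h4 : 0 ≤ volume.real A := measureReal_nonneg
    rw [balanced, abs_le]
    constructor <;> nlinarith
  eq_zero x hx := by
    rw [balanced, indicator_of_notMem hx, indicator_of_notMem fun h => hx (hAQ h)]; ring

/-- The averaged balanced function equals the local density minus α at points whose cube lies in
[0,1]^d, vanishes at points whose cube misses it, and is at most 1 in modulus on the shell between,
which has volume O(L). -/
theorem integral_sq_balanced_le {d : ℕ} {A : Set (E d)} (hA : MeasurableSet A) {ε L : ℝ}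
    (hL : 0 < L) (hL1 : L ≤ 1) (hu : IsUniformlyDistributed ε L A) :
    ∫ x, (∫ z, balanced A (x - z) ∂(cubeMeasure d L)) ^ 2 ≤ ε ^ 2 + d * 2 ^ d * L := by
  have := isProbabilityMeasure_cubeMeasure d hL
  obtain ⟨hAQ, hu⟩ := hu
  have hfb := isUnitBounded_balanced hA hAQ
  set α := volume.real A with hα
  have hα0 : 0 ≤ α := measureReal_nonneg
  have hα1 : α ≤ 1 := volume_real_le_one hAQ
  set V := volume.real (cube (0 : E d) L) with hV
  have hVL : V = L ^ d := volume_real_cube 0 hL.le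
  have hVpos : 0 < V := by rw [hVL]; positivity
  set f : E d → ℝ := fun x => ∫ z, balanced A (x - z) ∂(cubeMeasure d L) with hf
  set g : E d → ℝ := fun x => volume.real (A ∩ cube x L) / V with hg
  set q : E d → ℝ := fun x => volume.real (unitCube d ∩ cube x L) / V with hq
  have hmshift : ∀ {φ : E d → ℝ}, Measurable φ →
      Measurable fun x => ∫ z, φ (x - z) ∂(cubeMeasure d L) := fun hφ =>
    (hφ.comp (measurable_fst.sub measurable_snd) :
      Measurable fun p : E d × E d => _).stronglyMeasurable.integral_prod_right'.measurable
  have hgeq : ∀ x, ∫ z, A.indicator (fun _ => (1 : ℝ)) (x - z) ∂(cubeMeasure d L) = g x :=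
    fun x => integral_cubeMeasure_indicator hA L x
  have hfeq : ∀ x, f x = g x - α * q x := fun x => by
    simp only [hf, balanced]
    rw [integral_sub, integral_const_mul, integral_cubeMeasure_indicator hA L,
      integral_cubeMeasure_indicator (measurableSet_unitCube d) L]
    · exact Integrable.of_bound ((isUnitBounded_indicator hA hAQ).measurable.comp
        (measurable_const.sub measurable_id)).aestronglyMeasurable 1
        (ae_of_all _ fun z => (isUnitBounded_indicator hA hAQ).abs_le _)
    · exact (Integrable.of_bound ((isUnitBounded_indicator (measurableSet_unitCube d)
        subset_rfl).measurable.comp (measurable_const.sub measurable_id)).aestronglyMeasurable 1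
        (ae_of_all _ fun z => (isUnitBounded_indicator (measurableSet_unitCube d)
        subset_rfl).abs_le _)).const_mul _
  have hgm : Measurable g := by
    have := hmshift (isUnitBounded_indicator hA hAQ).measurable
    rwa [funext hgeq] at this
  have hratio : ∀ (S : Set (E d)) (x : E d), 0 ≤ volume.real (S ∩ cube x L) / V ∧
      volume.real (S ∩ cube x L) / V ≤ 1 := fun S x => by
    refine ⟨by positivity, (div_le_one hVpos).2 ?_⟩
    rw [hVL, ← volume_real_cube x hL.le]
    exact measureReal_mono inter_subset_right (volume_cube_ne_top x L)
  have hf1 : ∀ x, f x ^ 2 ≤ 1 := fun x => by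
    rw [hfeq]
    have h1 := hratio A x
    have h2 := hratio (unitCube d) x
    change 0 ≤ g x ∧ g x ≤ 1 at h1
    change 0 ≤ q x ∧ q x ≤ 1 at h2
    rw [sq_le_one_iff_abs_le_one, abs_le]
    constructor <;> nlinarith
  set outer := cube (cubeCenter d) (1 + L) with houter
  set inner := cube (cubeCenter d) (1 - L) with hinner
  have hout : ∀ x, x ∉ outer → f x = 0 := fun x hx => by
    have hemp : unitCube d ∩ cube x L = ∅ := by
      rw [← disjoint_iff_inter_eq_empty, disjoint_left]
      intro y hy hyx
      refine hx fun i => ?_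
      rw [unitCube_eq_cube] at hy
      have h1 := abs_le.1 (hy i)
      have h2 := abs_le.1 (hyx i)
      rw [abs_le]
      constructor <;> linarith
    have hemp2 : A ∩ cube x L = ∅ := subset_empty_iff.1
      (hemp ▸ inter_subset_inter_left _ hAQ)
    rw [hfeq]
    simp only [hg, hq, hemp, hemp2]
    simp
  have hin : ∀ x, x ∈ inner → f x = g x - α := fun x hx => by
    have hsub : cube x L ⊆ unitCube d := by
      intro y hy
      rw [unitCube_eq_cube]
      intro i
      have h1 := abs_le.1 (hx i)
      have h2 := abs_le.1 (hy i)
      rw [abs_le]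
      constructor <;> linarith
    rw [hfeq]
    simp only [hq]
    rw [inter_eq_right.2 hsub, volume_real_cube x hL.le, hVL, div_self (by positivity), mul_one]
  have hinQ : inner ⊆ unitCube d := by
    rw [unitCube_eq_cube]; exact cube_subset_cube _ (by linarith)
  have hBm : MeasurableSet (outer \ inner) := (measurableSet_cube _ _).diff (measurableSet_cube _ _)
  have hpt : ∀ x, f x ^ 2 ≤ (unitCube d).indicator (fun t => |g t - α| ^ 2) x +
      (outer \ inner).indicator (fun _ => (1 : ℝ)) x := fun x => by
    have hn1 : 0 ≤ (unitCube d).indicator (fun t => |g t - α| ^ 2) x :=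
      indicator_nonneg (fun _ _ => by positivity) x
    have hn2 := (indicator_one_mem_Icc (outer \ inner) x).1
    by_cases hx : x ∈ inner
    · rw [hin x hx, indicator_of_mem (hinQ hx), sq_abs]
      linarith
    · by_cases hx2 : x ∈ outer
      · rw [indicator_of_mem (show x ∈ outer \ inner from ⟨hx2, hx⟩)]
        linarith [hf1 x]
      · rw [hout x hx2]
        linarith
  have hBfin : volume (outer \ inner) ≠ ∞ :=
    ((measure_mono sdiff_subset).trans_lt (volume_cube_ne_top _ _).lt_top).ne
  have hi1 : Integrable ((unitCube d).indicator fun t => |g t - α| ^ 2) := by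
    rw [integrable_indicator_iff (measurableSet_unitCube d)]
    refine Measure.integrableOn_of_bounded (M := 1) (by rw [volume_unitCube]; simp)
      ((hgm.sub_const α).abs.pow_const 2).aestronglyMeasurable (ae_of_all _ fun x => ?_)
    have h1 := hratio A x
    change 0 ≤ g x ∧ g x ≤ 1 at h1
    rw [norm_pow, Real.norm_eq_abs, abs_abs]
    refine pow_le_one₀ (abs_nonneg _) (abs_le.2 ⟨by linarith, by linarith⟩)
  have hi2 : Integrable ((outer \ inner).indicator fun _ => (1 : ℝ)) :=
    (integrable_indicator_iff hBm).2 (integrableOn_const hBfin)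
  calc ∫ x, f x ^ 2 ≤ ∫ x, ((unitCube d).indicator (fun t => |g t - α| ^ 2) x +
        (outer \ inner).indicator (fun _ => (1 : ℝ)) x) :=
        integral_mono_of_nonneg (ae_of_all _ fun x => sq_nonneg _) (hi1.add hi2) (ae_of_all _ hpt)
    _ = (∫ t in unitCube d, |g t - α| ^ 2) + volume.real (outer \ inner) := by
        rw [integral_add hi1 hi2, integral_indicator (measurableSet_unitCube d),
          integral_indicator_const _ hBm, smul_eq_mul, mul_one]
    _ ≤ ε ^ 2 + d * 2 ^ d * L := by
        refine add_le_add hu ?_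
        refine (volume_real_cube_diff_le _ (by linarith) (by linarith)).trans ?_
        -- The exponent d - 1 is truncated at d = 0.
        rcases Nat.eq_zero_or_pos d with rfl | hd
        · simp
        have h2d : (2 : ℝ) ^ d = 2 * 2 ^ (d - 1) := by
          rw [← pow_succ', Nat.sub_add_cancel (by omega)]
        calc (1 + L - (1 - L)) * d * (1 + L) ^ (d - 1) ≤ (1 + L - (1 - L)) * d * 2 ^ (d - 1) := by
              gcongr
              · nlinarith
              · linarith
          _ = d * 2 ^ d * L := by rw [h2d]; ring

/-! ### Counting simplices in uniformly distributed sets -/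

/-- The multilinear form of which `simplexCount` is the diagonal. -/
def simplexForm {d k : ℕ} (v : Fin k → E d) (l : ℝ) (f : E d → ℝ) (G : Fin k → E d → ℝ) : ℝ :=
  ∫ p : E d × SO d, f p.1 * ∏ i, G i (p.1 - l • rot p.2 (v i)) ∂(volume.prod (haarSO d))

theorem measurable_simplexForm_integrand {d k : ℕ} (v : Fin k → E d) (l : ℝ) {f : E d → ℝ}
    (hf : Measurable f) {G : Fin k → E d → ℝ} (hG : ∀ i, Measurable (G i)) :
    Measurable fun p : E d × SO d => f p.1 * ∏ i, G i (p.1 - l • rot p.2 (v i)) := by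
  refine (hf.comp measurable_fst).mul (Finset.measurable_fun_prod _ fun i _ => ?_)
  refine (hG i).comp (measurable_fst.sub ?_)
  exact (((continuous_rot_left (v i)).measurable).comp measurable_snd).const_smul l

theorem integrable_simplexForm_integrand {d k : ℕ} (v : Fin k → E d) (l : ℝ) {f : E d → ℝ}
    (hf : IsUnitBounded f) {G : Fin k → E d → ℝ} (hG : ∀ i, Measurable (G i))
    (hG1 : ∀ i x, |G i x| ≤ 1) :
    Integrable (fun p : E d × SO d => f p.1 * ∏ i, G i (p.1 - l • rot p.2 (v i)))
      (volume.prod (haarSO d)) := by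
  refine integrable_of_abs_le_one_of_support (S := unitCube d ×ˢ univ)
    (measurable_simplexForm_integrand v l hf.measurable hG) (fun p => ?_) ?_ fun p hp => ?_
  · rw [abs_mul, Finset.abs_prod]
    exact mul_le_one₀ (hf.abs_le _) (Finset.prod_nonneg fun _ _ => abs_nonneg _)
      (Finset.prod_le_one (fun _ _ => abs_nonneg _) fun i _ => hG1 i _)
  · rw [Measure.prod_prod, volume_unitCube]; simp
  · rw [hf.eq_zero _ fun h => hp ⟨h, mem_univ _⟩, zero_mul]

theorem simplexForm_eq_integral {d k : ℕ} (v : Fin k → E d) (l : ℝ) {f : E d → ℝ}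
    (hf : IsUnitBounded f) {G : Fin k → E d → ℝ} (hG : ∀ i, Measurable (G i))
    (hG1 : ∀ i x, |G i x| ≤ 1) :
    simplexForm v l f G = ∫ x, ∫ U, f x * ∏ i, G i (x - l • rot U (v i)) ∂haarSO d :=
  integral_prod _ (integrable_simplexForm_integrand v l hf hG hG1)

/-- The functions `1_A`, with the first `m` replaced by `|A| 1_{[0,1]^d}`. -/
def hybrid {d k : ℕ} (A : Set (E d)) (m : ℕ) (i : Fin k) : E d → ℝ :=
  if i.1 < m then fun x => volume.real A * (unitCube d).indicator (fun _ => (1 : ℝ)) x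
  else A.indicator fun _ => (1 : ℝ)

theorem measurable_hybrid {d k : ℕ} {A : Set (E d)} (hA : MeasurableSet A) (m : ℕ) (i : Fin k) :
    Measurable (hybrid A m i) := by
  unfold hybrid
  split_ifs
  · exact (measurable_const.indicator (measurableSet_unitCube d)).const_mul _
  · exact measurable_const.indicator hA

theorem abs_hybrid_le {d k : ℕ} {A : Set (E d)} (hAQ : A ⊆ unitCube d) (m : ℕ) (i : Fin k)
    (x : E d) : |hybrid A m i x| ≤ 1 := by
  have h1 := indicator_one_mem_Icc A x
  have h2 := indicator_one_mem_Icc (unitCube d) x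
  have h3 := volume_real_le_one hAQ
  have h4 : 0 ≤ volume.real A := measureReal_nonneg
  unfold hybrid
  rw [abs_le]
  split_ifs
  · constructor <;> nlinarith
  · constructor <;> linarith

/-- One telescoping step: consecutive hybrids differ only in the factor j, where 1_A - α 1_{[0,1]^d}
is the balanced function. -/
theorem simplexForm_hybrid_sub {d k : ℕ} (v : Fin k → E d) (l : ℝ) {A : Set (E d)}
    (hA : MeasurableSet A) (hAQ : A ⊆ unitCube d) (j : Fin k) :
    simplexForm v l (A.indicator fun _ => (1 : ℝ)) (hybrid A j.1) -
        simplexForm v l (A.indicator fun _ => (1 : ℝ)) (hybrid A (j.1 + 1)) =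
      simplexForm v l (A.indicator fun _ => (1 : ℝ))
        (Function.update (hybrid A j.1) j (balanced A)) := by
  have hf := isUnitBounded_indicator hA hAQ
  unfold simplexForm
  rw [← integral_sub (integrable_simplexForm_integrand v l hf (measurable_hybrid hA _)
      (abs_hybrid_le hAQ _)) (integrable_simplexForm_integrand v l hf (measurable_hybrid hA _)
      (abs_hybrid_le hAQ _))]
  refine integral_congr_ae (ae_of_all _ fun p => ?_)
  simp only
  rw [← mul_sub]
  congr 1
  rw [← Finset.mul_prod_erase _ _ (Finset.mem_univ j), ← Finset.mul_prod_erase _ _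
    (Finset.mem_univ j), ← Finset.mul_prod_erase _ _ (Finset.mem_univ j), Function.update_self]
  have h1 : ∏ i ∈ Finset.univ.erase j, hybrid A (j.1 + 1) i (p.1 - l • rot p.2 (v i)) =
      ∏ i ∈ Finset.univ.erase j, hybrid A j.1 i (p.1 - l • rot p.2 (v i)) := by
    refine Finset.prod_congr rfl fun i hi => ?_
    have hne : i.1 ≠ j.1 := fun h => Finset.ne_of_mem_erase hi (Fin.ext h)
    have : i.1 < j.1 + 1 ↔ i.1 < j.1 := by omega
    simp only [hybrid, this]
  have h2 : ∏ i ∈ Finset.univ.erase j,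
        Function.update (hybrid A j.1) j (balanced A) i (p.1 - l • rot p.2 (v i)) =
      ∏ i ∈ Finset.univ.erase j, hybrid A j.1 i (p.1 - l • rot p.2 (v i)) := by
    refine Finset.prod_congr rfl fun i hi => ?_
    rw [Function.update_of_ne (Finset.ne_of_mem_erase hi)]
  rw [h1, h2, ← sub_mul]
  congr 1
  simp [hybrid, balanced]

theorem simplexCount_eq_simplexForm {d k : ℕ} (v : Fin k → E d) (l : ℝ) {A : Set (E d)}
    (hA : MeasurableSet A) (hAQ : A ⊆ unitCube d) :
    simplexCount A v l =
      simplexForm v l (A.indicator fun _ => (1 : ℝ)) (hybrid A 0) := by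
  rw [simplexForm_eq_integral v l (isUnitBounded_indicator hA hAQ) (measurable_hybrid hA _)
    (abs_hybrid_le hAQ _)]
  simp [simplexCount, hybrid]

/-- The bound for the form with one balanced factor. -/
def formBound (d : ℕ) (c l ε L : ℝ) : ℝ :=
  √(ε ^ 2 + d * 2 ^ d * L + chordConst d * √(d * (L / 2) / (l * c)))

theorem abs_simplexForm_sub_le {d k : ℕ} (hk : 1 ≤ k) (hd : k + 1 ≤ d) {v : Fin k → E d}
    (hv : LinearIndependent ℝ v) {l : ℝ} (hl : 0 < l) {A : Set (E d)} (hA : MeasurableSet A)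
    {ε L : ℝ} (hL : 0 < L) (hL1 : L ≤ 1) (hu : IsUniformlyDistributed ε L A) (m : ℕ) (hm : m ≤ k) :
    |simplexForm v l (A.indicator fun _ => (1 : ℝ)) (hybrid A 0) -
        simplexForm v l (A.indicator fun _ => (1 : ℝ)) (hybrid A m)| ≤
      m * formBound d (simplexWidth v) l ε L := by
  have hAQ := hu.1
  have := isProbabilityMeasure_cubeMeasure d hL
  induction m with
  | zero => simp
  | succ m ih =>
    have hj : m < k := hm
    have hstep := simplexForm_hybrid_sub v l hA hAQ ⟨m, hj⟩
    have hbal := isUnitBounded_balanced hA hAQ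
    set G := Function.update (hybrid A m) (⟨m, hj⟩ : Fin k) (balanced A) with hG
    have hGj : G ⟨m, hj⟩ = balanced A := Function.update_self ..
    have hGi : ∀ i, i ≠ ⟨m, hj⟩ → G i = hybrid A m i := fun i hi => Function.update_of_ne hi ..
    have hGm : ∀ i, Measurable (G i) := fun i => by
      rcases eq_or_ne i ⟨m, hj⟩ with rfl | hi
      · rw [hGj]; exact hbal.measurable
      · rw [hGi i hi]; exact measurable_hybrid hA m i
    have hG1 : ∀ i x, |G i x| ≤ 1 := fun i x => by
      rcases eq_or_ne i ⟨m, hj⟩ with rfl | hi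
      · rw [hGj]; exact hbal.abs_le x
      · rw [hGi i hi]; exact abs_hybrid_le hAQ m i x
    have h1 := sq_simplexForm_le hk hd hv hl (isUnitBounded_indicator hA hAQ) hGm hG1
      (j := ⟨m, hj⟩) (by rw [hGj]; exact hbal) (by positivity) (ae_cubeMeasure d L)
    rw [hGj, ← simplexForm_eq_integral v l (isUnitBounded_indicator hA hAQ) hGm hG1] at h1
    have h2 : |simplexForm v l (A.indicator fun _ => (1 : ℝ)) G| ≤
        formBound d (simplexWidth v) l ε L := by
      refine Real.abs_le_sqrt (h1.trans ?_)
      gcongr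
      exact integral_sq_balanced_le hA hL hL1 hu
    rw [← hstep] at h2
    have h3 := ih (by omega)
    have h4 := abs_sub_le (simplexForm v l (A.indicator fun _ => (1 : ℝ)) (hybrid A 0))
      (simplexForm v l (A.indicator fun _ => (1 : ℝ)) (hybrid A m))
      (simplexForm v l (A.indicator fun _ => (1 : ℝ)) (hybrid A (m + 1)))
    push_cast
    linarith

/-- The main term: if x lies at distance at least lR from the faces of the cube, all the vertices
stay inside and the integrand is exactly α^k 1_A(x). The error is at most the volume of the
remaining shell. -/
theorem abs_simplexForm_hybrid_sub_pow_le {d k : ℕ} (hd : k + 1 ≤ d) {v : Fin k → E d} {R : ℝ}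
    (hR : ∀ j, ‖v j‖ ≤ R) (hR0 : 0 ≤ R) {l : ℝ} (hl : 0 < l) {A : Set (E d)}
    (hA : MeasurableSet A) (hAQ : A ⊆ unitCube d) :
    |simplexForm v l (A.indicator fun _ => (1 : ℝ)) (hybrid A k) - volume.real A ^ (k + 1)| ≤
      2 * d * (l * R) := by
  set α := volume.real A with hα
  have hα0 : 0 ≤ α := measureReal_nonneg
  have hα1 : α ≤ 1 := volume_real_le_one hAQ
  have hf := isUnitBounded_indicator hA hAQ
  have hlR : 0 ≤ l * R := by positivity
  set inner := cube (cubeCenter d) (1 - 2 * (l * R)) with hinner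
  have hBm : MeasurableSet (unitCube d \ inner) :=
    (measurableSet_unitCube d).diff (measurableSet_cube _ _)
  have hvol : volume.real (unitCube d \ inner) ≤ 2 * d * (l * R) := by
    -- When 2lR > 1 the inner cube has negative side, but the claimed bound then exceeds the volume
    -- 1 of the unit cube.
    rcases le_or_gt (2 * (l * R)) 1 with h | h
    · rw [unitCube_eq_cube]
      refine (volume_real_cube_diff_le _ (by linarith) (by linarith)).trans_eq ?_
      rw [one_pow]; ring
    · have hd1 : (1 : ℝ) ≤ d := by exact_mod_cast (by omega : 1 ≤ d)
      refine (volume_real_le_one sdiff_subset).trans ?_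
      nlinarith
  have hA1 : Integrable (fun p : E d × SO d => A.indicator (fun _ => (1 : ℝ)) p.1)
      (volume.prod (haarSO d)) := hf.integrable.comp_fst _
  have hpow : α ^ (k + 1) =
      ∫ p : E d × SO d, α ^ k * A.indicator (fun _ => (1 : ℝ)) p.1 ∂(volume.prod (haarSO d)) := by
    rw [integral_const_mul, integral_fun_fst (A.indicator fun _ => (1 : ℝ)),
      integral_indicator_const _ hA]
    simp [pow_succ, hα]
  rw [hpow, simplexForm, ← integral_sub (integrable_simplexForm_integrand v l hf
    (measurable_hybrid hA _) (abs_hybrid_le hAQ _)) (hA1.const_mul _)]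
  have hi2 : Integrable ((unitCube d \ inner).indicator fun _ => (1 : ℝ)) :=
    (isUnitBounded_indicator hBm sdiff_subset).integrable
  have hi3 : Integrable
      (fun p : E d × SO d => (unitCube d \ inner).indicator (fun _ => (1 : ℝ)) p.1)
      (volume.prod (haarSO d)) := hi2.comp_fst _
  rw [← Real.norm_eq_abs]
  refine (norm_integral_le_of_norm_le hi3 (ae_of_all _ fun p => ?_)).trans ?_
  · have hprod : ∏ i : Fin k, hybrid A k i (p.1 - l • rot p.2 (v i)) =
        α ^ k * ∏ i : Fin k, (unitCube d).indicator (fun _ => (1 : ℝ))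
          (p.1 - l • rot p.2 (v i)) := by
      simp [hybrid, Finset.prod_mul_distrib, hα]
    have hP0 : 0 ≤ ∏ i : Fin k, (unitCube d).indicator (fun _ => (1 : ℝ))
          (p.1 - l • rot p.2 (v i)) :=
      Finset.prod_nonneg fun i _ => (indicator_one_mem_Icc _ _).1
    have hP1 : ∏ i : Fin k, (unitCube d).indicator (fun _ => (1 : ℝ))
          (p.1 - l • rot p.2 (v i)) ≤ 1 :=
      Finset.prod_le_one (fun i _ => (indicator_one_mem_Icc _ _).1)
        fun i _ => (indicator_one_mem_Icc _ _).2
    have hαk0 : 0 ≤ α ^ k := by positivity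
    have hαk1 : α ^ k ≤ 1 := pow_le_one₀ hα0 hα1
    rw [hprod]
    by_cases hpA : p.1 ∈ A
    · rw [indicator_of_mem hpA, one_mul, mul_one]
      by_cases hpi : p.1 ∈ inner
      · have h1 : ∀ i, p.1 - l • rot p.2 (v i) ∈ unitCube d := fun i => by
          rw [unitCube_eq_cube]
          intro n
          have h2 := abs_le.1 (hpi n)
          have h3 : |(l • rot p.2 (v i)) n| ≤ l * R := by
            rw [← Real.norm_eq_abs]
            refine (PiLp.norm_apply_le _ n).trans ?_
            rw [norm_smul, norm_rot, Real.norm_eq_abs, abs_of_pos hl]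
            have := hR i
            gcongr
          have h4 := abs_le.1 h3
          rw [PiLp.sub_apply, abs_le]
          constructor <;> linarith
        simp only [indicator_of_mem (h1 _), Finset.prod_const_one, mul_one, sub_self, norm_zero]
        exact (indicator_one_mem_Icc _ _).1
      · rw [indicator_of_mem (show p.1 ∈ unitCube d \ inner from ⟨hAQ hpA, hpi⟩), Real.norm_eq_abs,
          abs_le]
        constructor <;> nlinarith
    · rw [indicator_of_notMem hpA, zero_mul, mul_zero, sub_self, norm_zero]
      exact (indicator_one_mem_Icc _ _).1
  · rw [integral_fun_fst, integral_indicator_const _ hBm]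
    simpa using hvol

theorem abs_simplexCount_sub_le {d k : ℕ} (hk : 1 ≤ k) (hd : k + 1 ≤ d) {v : Fin k → E d}
    (hv : LinearIndependent ℝ v) {R : ℝ} (hR : ∀ j, ‖v j‖ ≤ R) {l : ℝ} (hl : 0 < l)
    {A : Set (E d)} (hA : MeasurableSet A) {ε L : ℝ} (hL : 0 < L) (hL1 : L ≤ 1)
    (hu : IsUniformlyDistributed ε L A) :
    |simplexCount A v l - volume.real A ^ (k + 1)| ≤
      k * formBound d (simplexWidth v) l ε L + 2 * d * (l * R) := by
  have h1 := abs_simplexForm_sub_le hk hd hv hl hA hL hL1 hu k le_rfl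
  have h2 := abs_simplexForm_hybrid_sub_pow_le hd hR
    ((norm_nonneg _).trans (hR ⟨0, hk⟩)) hl hA hu.1
  rw [simplexCount_eq_simplexForm v l hA hu.1]
  have h3 := abs_sub_le (simplexForm v l (A.indicator fun _ => (1 : ℝ)) (hybrid A 0))
    (simplexForm v l (A.indicator fun _ => (1 : ℝ)) (hybrid A k)) (volume.real A ^ (k + 1))
  linarith

theorem simplexCount_mem_Icc {d k : ℕ} (v : Fin k → E d) (l : ℝ) {A : Set (E d)}
    (hA : MeasurableSet A) (hAQ : A ⊆ unitCube d) :
    0 ≤ simplexCount A v l ∧ simplexCount A v l ≤ 1 := by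
  have hf := isUnitBounded_indicator hA hAQ
  have hP0 : ∀ p : E d × SO d, 0 ≤ ∏ i : Fin k, A.indicator (fun _ => (1 : ℝ))
      (p.1 - l • rot p.2 (v i)) := fun p =>
    Finset.prod_nonneg fun i _ => (indicator_one_mem_Icc _ _).1
  have hP1 : ∀ p : E d × SO d, ∏ i : Fin k, A.indicator (fun _ => (1 : ℝ))
      (p.1 - l • rot p.2 (v i)) ≤ 1 := fun p =>
    Finset.prod_le_one (fun i _ => (indicator_one_mem_Icc _ _).1)
      fun i _ => (indicator_one_mem_Icc _ _).2
  rw [simplexCount_eq_simplexForm v l hA hAQ]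
  have hint := integrable_simplexForm_integrand v l hf (measurable_hybrid hA 0)
    (abs_hybrid_le hAQ 0)
  unfold simplexForm
  simp only [hybrid, not_lt_zero, if_false] at hint ⊢
  refine ⟨integral_nonneg fun p => mul_nonneg (indicator_one_mem_Icc _ _).1 (hP0 p), ?_⟩
  have hA1 : Integrable (fun p : E d × SO d => A.indicator (fun _ => (1 : ℝ)) p.1)
      (volume.prod (haarSO d)) := hf.integrable.comp_fst _
  refine (integral_mono hint hA1 fun p =>
    mul_le_of_le_one_right (indicator_one_mem_Icc _ _).1 (hP1 p)).trans ?_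
  rw [integral_fun_fst, integral_indicator_const _ hA]
  simpa using volume_real_le_one hAQ

theorem containsCopy_of_simplexCount_ne_zero {d k : ℕ} (hd : k + 1 ≤ d) {v : Fin k → E d} {l : ℝ}
    {A : Set (E d)} (h : simplexCount A v l ≠ 0) : ContainsCopy A l (simplex v) := by
  obtain ⟨x, U, hxU⟩ : ∃ (x : E d) (U : SO d), A.indicator (fun _ => (1 : ℝ)) x *
      ∏ j : Fin k, A.indicator (fun _ => (1 : ℝ)) (x - l • rot U (v j)) ≠ 0 := by
    by_contra! hcon
    exact h (by simp [simplexCount, hcon])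
  obtain ⟨S, hS⟩ := exists_rot_eq_neg hd v
  refine ⟨x, U * S, ?_⟩
  rintro _ ⟨p, hp, rfl⟩
  rcases hp with rfl | ⟨j, rfl⟩
  · have := mem_of_indicator_ne_zero (left_ne_zero_of_mul hxU)
    simpa [rot_zero] using this
  · have := mem_of_indicator_ne_zero
      (Finset.prod_ne_zero_iff.1 (right_ne_zero_of_mul hxU) j (Finset.mem_univ j))
    simpa [rot_mul, hS, rot_neg, sub_eq_add_neg] using this

/-- For fixed U each vertex map is a translation in x, so by Fubini the vertices avoid a given null
set for almost every (x, U). -/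
theorem simplexCount_congr {d k : ℕ} (v : Fin k → E d) (l : ℝ) {A B : Set (E d)}
    (h : A =ᵐ[volume] B) : simplexCount A v l = simplexCount B v l := by
  obtain ⟨N, hN, hNm, hN0⟩ := exists_measurable_superset_of_null (ae_eq_set.1 h).1
  obtain ⟨N', hN', hNm', hN0'⟩ := exists_measurable_superset_of_null (ae_eq_set.1 h).2
  have hmem : ∀ x, x ∉ N ∪ N' →
      A.indicator (fun _ => (1 : ℝ)) x = B.indicator (fun _ => (1 : ℝ)) x := fun x hx => by
    have h1 : x ∈ A → x ∈ B := fun hxA => by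
      by_contra hxB; exact hx (Or.inl (hN ⟨hxA, hxB⟩))
    have h2 : x ∈ B → x ∈ A := fun hxB => by
      by_contra hxA; exact hx (Or.inr (hN' ⟨hxB, hxA⟩))
    by_cases hxA : x ∈ A
    · rw [indicator_of_mem hxA, indicator_of_mem (h1 hxA)]
    · rw [indicator_of_notMem hxA, indicator_of_notMem fun hxB => hxA (h2 hxB)]
  have hnull : volume (N ∪ N') = 0 := measure_union_null hN0 hN0'
  have hae : ∀ i : Fin k, ∀ᵐ p : E d × SO d ∂(volume.prod (haarSO d)),
      p.1 - l • rot p.2 (v i) ∉ N ∪ N' := fun i => by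
    have hm : Measurable fun p : E d × SO d => p.1 - l • rot p.2 (v i) :=
      measurable_fst.sub
        ((((continuous_rot_left (v i)).measurable).comp measurable_snd).const_smul l)
    have hz : (volume.prod (haarSO d)) ((fun p : E d × SO d => p.1 - l • rot p.2 (v i)) ⁻¹'
        (N ∪ N')) = 0 := by
      rw [Measure.prod_apply_symm (hm (hNm.union hNm'))]
      refine (lintegral_congr fun U => ?_).trans lintegral_zero
      exact ((measurePreserving_sub_right volume (l • rot U (v i))).measure_preimage
        (hNm.union hNm').nullMeasurableSet).trans hnull
    exact measure_eq_zero_iff_ae_notMem.1 hz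
  have hae2 := Measure.ae_ae_of_ae_prod (ae_all_iff.2 hae)
  refine integral_congr_ae ?_
  filter_upwards [hae2, measure_eq_zero_iff_ae_notMem.1 hnull] with x hx hx0
  refine integral_congr_ae ?_
  filter_upwards [hx] with U hU
  rw [hmem x hx0]
  congr 1
  exact Finset.prod_congr rfl fun i _ => hmem _ (hU i)

/-! ### From the counting estimate to the bound with exponents -1/6 and 2/3 -/

theorem rpow_mul_rpow_pow_six {c ε : ℝ} (hc : 0 < c) (hε : 0 < ε) :
    (c ^ (-(1 / 6) : ℝ) * ε ^ (2 / 3 : ℝ)) ^ 6 = ε ^ 4 / c := by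
  have h1 : (c ^ (-(1 / 6) : ℝ)) ^ 6 = c⁻¹ := by
    rw [← Real.rpow_natCast, ← Real.rpow_mul hc.le, ← Real.rpow_neg_one]
    norm_num
  have h2 : (ε ^ (2 / 3 : ℝ)) ^ 6 = ε ^ 4 := by
    rw [← Real.rpow_natCast, ← Real.rpow_mul hε.le, ← Real.rpow_natCast]
    norm_num
  rw [mul_pow, h1, h2, div_eq_inv_mul]

theorem IsUniformlyDistributed.congr {d : ℕ} {ε L : ℝ} {A B : Set (E d)}
    (hA : IsUniformlyDistributed ε L A) (hBA : B ⊆ A) (h : B =ᵐ[volume] A) :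
    IsUniformlyDistributed ε L B := by
  refine ⟨hBA.trans hA.1, ?_⟩
  have h1 : ∀ t : E d, volume.real (B ∩ cube t L) = volume.real (A ∩ cube t L) := fun t =>
    measureReal_congr (h.inter (ae_eq_refl _))
  simp only [h1, measureReal_congr h]
  exact hA.2

theorem ContainsCopy.mono {d : ℕ} {A B : Set (E d)} (hAB : A ⊆ B) {l : ℝ} {Δ : Set (E d)}
    (h : ContainsCopy A l Δ) : ContainsCopy B l Δ := by
  obtain ⟨x, U, hxU⟩ := h
  exact ⟨x, U, hxU.trans hAB⟩

theorem containsCopy_of_error_lt {d k : ℕ} (hd : k + 1 ≤ d) {v : Fin k → E d} {l : ℝ}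
    {A : Set (E d)} {e : ℝ} (h : |simplexCount A v l - volume.real A ^ (k + 1)| ≤ e)
    (he : e < volume.real A ^ (k + 1)) : ContainsCopy A l (simplex v) := by
  refine containsCopy_of_simplexCount_ne_zero hd fun h0 => ?_
  rw [h0, zero_sub, abs_neg] at h
  exact absurd ((le_abs_self _).trans h) (not_le.2 he)

/-- The constant in the counting estimate for simplices. -/
def countConst (k d : ℕ) : ℝ := k * √(1 + d * 2 ^ d + chordConst d * d) + 2 * d + 1

/-- With X = c^{-1/6} ε^{2/3} one has X⁶ = ε⁴/c, so every error term can be compared with a natural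
power of X. -/
theorem abs_simplexCount_sub_le_countConst {k d : ℕ} (hk : 1 ≤ k) (hd : k + 1 ≤ d) {R : ℝ}
    (hR : 0 < R) {v : Fin k → E d} (hv : LinearIndependent ℝ v) (hvR : ∀ j, ‖v j‖ ≤ R)
    (hc1 : simplexWidth v ≤ 1) {ε l : ℝ} (hl : 0 < l) (hle : l ≤ ε) (hε1 : ε ≤ 1)
    (hεR : ε * R ^ 3 ≤ 1) {A : Set (E d)} (hA : MeasurableSet A)
    (hu : IsUniformlyDistributed ε (ε ^ 4 * l) A) :
    |simplexCount A v l - volume.real A ^ (k + 1)| ≤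
      countConst k d * (simplexWidth v ^ (-(1 / 6) : ℝ) * ε ^ (2 / 3 : ℝ)) := by
  have hε : 0 < ε := hl.trans_le hle
  set c := simplexWidth v with hc
  have hcpos : 0 < c := simplexWidth_pos hk hv
  have hX6 := rpow_mul_rpow_pow_six hcpos hε
  set X := c ^ (-(1 / 6) : ℝ) * ε ^ (2 / 3 : ℝ) with hX
  have hXpos : 0 < X := by positivity
  clear_value X
  have hC1 := chordConst_pos d
  have hd1 : (1 : ℝ) ≤ d := by exact_mod_cast (by omega : 1 ≤ d)
  -- For X > 1 nothing is to be proved: the count and α^{k+1} lie in [0,1] and the constant is at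
  -- least 1.
  rcases le_or_gt X 1 with hX1 | hX1
  · have hε4 : ε ^ 4 ≤ X ^ 6 := by
      rw [hX6]; exact le_div_self (by positivity) hcpos hc1
    have hεX : ε ≤ X := by
      refine le_of_pow_le_pow_left₀ (n := 6) (by norm_num) hXpos.le (le_trans ?_ hε4)
      exact pow_le_pow_of_le_one hε.le hε1 (by norm_num)
    -- The condition ε R³ ≤ 1 serves only here: it absorbs R into X through (εR)⁶ = ε⁴ (εR³)².
    have hlRX : l * R ≤ X := by
      refine (mul_le_mul_of_nonneg_right hle hR.le).trans ?_
      refine le_of_pow_le_pow_left₀ (n := 6) (by norm_num) hXpos.le (le_trans ?_ hε4)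
      calc (ε * R) ^ 6 = ε ^ 4 * (ε * R ^ 3) ^ 2 := by ring
        _ ≤ ε ^ 4 * 1 := by
            gcongr
            exact pow_le_one₀ (by positivity) hεR
        _ = ε ^ 4 := mul_one _
    have hLX : ε ^ 4 * l ≤ X ^ 2 := by
      calc ε ^ 4 * l ≤ ε ^ 4 * 1 := by gcongr; linarith
        _ ≤ X ^ 6 := by linarith
        _ ≤ X ^ 2 := pow_le_pow_of_le_one hXpos.le hX1 (by norm_num)
    have hsqrt : √(d * (ε ^ 4 * l / 2) / (l * c)) ≤ d * X ^ 2 := by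
      -- The scale l cancels and leaves √(d X⁶ / 2); the power X³ is then weakened to X².
      have h1 : √(d * (ε ^ 4 * l / 2) / (l * c)) ≤ d * X ^ 3 := by
        refine Real.sqrt_le_iff.2 ⟨by positivity, ?_⟩
        have h2 : d * (ε ^ 4 * l / 2) / (l * c) = d / 2 * X ^ 6 := by
          rw [hX6]; field_simp
        rw [h2, mul_pow, ← pow_mul]
        gcongr
        nlinarith
      exact h1.trans (mul_le_mul_of_nonneg_left
        (pow_le_pow_of_le_one hXpos.le hX1 (by norm_num : 2 ≤ 3)) (by positivity))
    have hform : formBound d c l ε (ε ^ 4 * l) ≤ √(1 + d * 2 ^ d + chordConst d * d) * X := by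
      unfold formBound
      refine Real.sqrt_le_iff.2 ⟨by positivity, ?_⟩
      rw [mul_pow, Real.sq_sqrt (by positivity)]
      calc ε ^ 2 + d * 2 ^ d * (ε ^ 4 * l) + chordConst d * √(d * (ε ^ 4 * l / 2) / (l * c))
          ≤ X ^ 2 + d * 2 ^ d * X ^ 2 + chordConst d * (d * X ^ 2) := by gcongr
        _ = (1 + d * 2 ^ d + chordConst d * d) * X ^ 2 := by ring
    have hL1 : ε ^ 4 * l ≤ 1 := hLX.trans (pow_le_one₀ hXpos.le hX1)
    refine (abs_simplexCount_sub_le hk hd hv hvR hl hA (by positivity) hL1 hu).trans ?_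
    calc k * formBound d c l ε (ε ^ 4 * l) + 2 * d * (l * R)
        ≤ k * (√(1 + d * 2 ^ d + chordConst d * d) * X) + 2 * d * X := by gcongr
      _ ≤ countConst k d * X := by unfold countConst; linarith
  · have h1 := simplexCount_mem_Icc v l hA hu.1
    have h2 : volume.real A ^ (k + 1) ≤ 1 :=
      pow_le_one₀ measureReal_nonneg (volume_real_le_one hu.1)
    have h3 : 0 ≤ volume.real A ^ (k + 1) := pow_nonneg measureReal_nonneg _
    have h4 : 1 ≤ countConst k d := by
      unfold countConst
      have : 0 ≤ k * √(1 + d * 2 ^ d + chordConst d * d) + 2 * d := by positivity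
      linarith
    refine (abs_le.2 ⟨by linarith [h1.1], by linarith [h1.2]⟩ : _ ≤ (1 : ℝ)).trans ?_
    nlinarith

/-! ### Sets of positive upper Banach density -/

/-- A one-sided bound controls the variance: |g - α|² ≤ |g - α| ≤ (G - g) + (G - α), and the mean of
g over the unit cube is α up to the mass O(L) that spills outside. -/
theorem integral_sq_density_le {d : ℕ} {A : Set (E d)} (hA : MeasurableSet A)
    (hAQ : A ⊆ unitCube d) {L : ℝ} (hL : 0 < L) (hL1 : L ≤ 1) {G : ℝ} (hαG : volume.real A ≤ G)
    (hG : ∀ t : E d, volume.real (A ∩ cube t L) / volume.real (cube (0 : E d) L) ≤ G) :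
    ∫ t in unitCube d,
      |volume.real (A ∩ cube t L) / volume.real (cube (0 : E d) L) - volume.real A| ^ 2 ≤
        2 * (G - volume.real A) + d * 2 ^ d * L := by
  have := isProbabilityMeasure_cubeMeasure d hL
  have hf := isUnitBounded_indicator hA hAQ
  set α := volume.real A with hα
  have hα0 : 0 ≤ α := measureReal_nonneg
  have hα1 : α ≤ 1 := volume_real_le_one hAQ
  set V := volume.real (cube (0 : E d) L) with hV
  have hVL : V = L ^ d := volume_real_cube 0 hL.le
  have hVpos : 0 < V := by rw [hVL]; positivity
  set g : E d → ℝ := fun x => volume.real (A ∩ cube x L) / V with hg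
  have hg01 : ∀ x, 0 ≤ g x ∧ g x ≤ 1 := fun x => by
    refine ⟨by positivity, (div_le_one hVpos).2 ?_⟩
    rw [hVL, ← volume_real_cube x hL.le]
    exact measureReal_mono inter_subset_right (volume_cube_ne_top x L)
  have hgeq : (fun x => ∫ z, A.indicator (fun _ => (1 : ℝ)) (x - z) ∂(cubeMeasure d L)) = g :=
    funext fun x => integral_cubeMeasure_indicator hA L x
  have hint2 := hf.integrable_comp_sub (P := cubeMeasure d L) measurable_id
  have hgint : Integrable g := hgeq ▸ hint2.integral_prod_left
  have hgα : ∫ x, g x = α := by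
    rw [← hgeq, integral_integral_swap hint2]
    have h1 : ∀ z : E d, ∫ x, A.indicator (fun _ => (1 : ℝ)) (x - z) = α := fun z => by
      rw [integral_sub_right_eq_self (A.indicator fun _ => (1 : ℝ)) z,
        integral_indicator_const _ hA]
      simp [hα]
    simp [h1]
  set outer := cube (cubeCenter d) (1 + L) with houter
  have hout : ∀ x, x ∉ outer → g x = 0 := fun x hx => by
    have hemp : A ∩ cube x L = ∅ := by
      rw [← disjoint_iff_inter_eq_empty, disjoint_left]
      intro y hy hyx
      refine hx fun i => ?_
      have hy := hAQ hy
      rw [unitCube_eq_cube] at hy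
      have h1 := abs_le.1 (hy i)
      have h2 := abs_le.1 (hyx i)
      rw [abs_le]
      constructor <;> linarith
    simp only [hg, hemp]
    simp
  have hvol : volume.real (outer \ unitCube d) ≤ d * 2 ^ d * L := by
    rw [unitCube_eq_cube]
    refine (volume_real_cube_diff_le _ (by linarith) (by linarith)).trans ?_
    calc (1 + L - 1) * d * (1 + L) ^ (d - 1) ≤ (1 + L - 1) * d * 2 ^ d := by
          have h2 : (1 + L) ^ (d - 1) ≤ 2 ^ d :=
            (pow_le_pow_left₀ (by linarith) (by linarith) _).trans
              (pow_le_pow_right₀ (by norm_num) (Nat.sub_le d 1))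
          have h3 : 0 ≤ 1 + L - 1 := by linarith
          gcongr
      _ = d * 2 ^ d * L := by ring
  have hQint : α - d * 2 ^ d * L ≤ ∫ x in unitCube d, g x := by
    have h1 := integral_add_compl (measurableSet_unitCube d) hgint
    have h2 : ∫ x in (unitCube d)ᶜ, g x = ∫ x in outer \ unitCube d, g x := by
      refine setIntegral_eq_of_subset_of_forall_sdiff_eq_zero
        (measurableSet_unitCube d).compl (fun x hx => hx.2) fun x hx => ?_
      exact hout x fun h => hx.2 ⟨h, hx.1⟩
    have hfin : volume (outer \ unitCube d) ≠ ∞ :=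
      ((measure_mono sdiff_subset).trans_lt (volume_cube_ne_top _ _).lt_top).ne
    have h3 := norm_setIntegral_le_of_norm_le_const (μ := volume) (s := outer \ unitCube d)
      (f := g) (C := 1) hfin.lt_top (fun x _ => by
        rw [Real.norm_eq_abs, abs_of_nonneg (hg01 x).1]; exact (hg01 x).2)
    have h4 := (le_abs_self _).trans h3
    rw [h2, hgα] at h1
    linarith
  have hconst : ∀ b : ℝ, ∫ _x in unitCube d, b = b := fun b => by
    rw [setIntegral_const, Measure.real, volume_unitCube]; simp
  have hQfin : volume (unitCube d) ≠ ∞ := by rw [volume_unitCube]; simp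
  calc ∫ t in unitCube d, |g t - α| ^ 2 ≤ ∫ t in unitCube d, ((2 * G - α) - g t) := by
        refine integral_mono_of_nonneg (ae_of_all _ fun _ => by positivity)
          ((integrableOn_const hQfin).sub hgint.integrableOn) (ae_of_all _ fun t => ?_)
        have h1 := hg01 t
        have h2 : |g t - α| ≤ 1 := abs_le.2 ⟨by linarith, by linarith⟩
        have h3 : |g t - α| ≤ (2 * G - α) - g t := by
          have := hG t
          change g t ≤ G at this
          exact abs_le.2 ⟨by linarith, by linarith⟩
        have h4 := abs_nonneg (g t - α)
        simp only
        nlinarith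
    _ = (2 * G - α) - ∫ t in unitCube d, g t := by
        rw [integral_sub (integrable_const_iff.2 (Or.inr (isFiniteMeasure_restrict.2 hQfin)))
          hgint.integrableOn, hconst]
    _ ≤ 2 * (G - α) + d * 2 ^ d * L := by linarith

/-- The similarity that maps `[0,1]^d` onto the cube of side `N` centred at `t`. -/
def blowUp {d : ℕ} (t : E d) (N : ℝ) (x : E d) : E d := N • (x - cubeCenter d) + t

theorem measurable_blowUp {d : ℕ} (t : E d) (N : ℝ) : Measurable (blowUp t N) := by
  unfold blowUp; fun_prop

theorem volume_real_preimage_blowUp {d : ℕ} (t : E d) {N : ℝ} (hN : 0 < N) (S : Set (E d)) :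
    volume.real (blowUp t N ⁻¹' S) = volume.real S / N ^ d := by
  have h : blowUp t N ⁻¹' S = (fun x : E d => x + -cubeCenter d) ⁻¹'
      ((fun x : E d => N • x) ⁻¹' ((fun x : E d => x + t) ⁻¹' S)) := by
    ext x; simp [blowUp, sub_eq_add_neg]
  rw [h, Measure.real, measure_preimage_add_right, Measure.addHaar_preimage_smul _ hN.ne',
    measure_preimage_add_right, ENNReal.toReal_mul, finrank_euclideanSpace_fin,
    ENNReal.toReal_ofReal (abs_nonneg _), abs_of_pos (by positivity), Measure.real, div_eq_inv_mul]

theorem preimage_blowUp_cube {d : ℕ} (t s : E d) {N : ℝ} (hN : 0 < N) (M : ℝ) :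
    blowUp t N ⁻¹' cube (blowUp t N s) M = cube s (M / N) := by
  ext x
  refine forall_congr' fun i => ?_
  have h : (blowUp t N x) i - (blowUp t N s) i = N * (x i - s i) := by
    simp [blowUp]; ring
  rw [h, abs_mul, abs_of_pos hN, div_right_comm, le_div_iff₀ hN, mul_comm]

theorem preimage_blowUp_cube_center {d : ℕ} (t : E d) {N : ℝ} (hN : 0 < N) :
    blowUp t N ⁻¹' cube t N = unitCube d := by
  have h := preimage_blowUp_cube t (cubeCenter d) hN N
  rw [div_self hN.ne', ← unitCube_eq_cube] at h
  rw [← h]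
  simp [blowUp]

theorem ContainsCopy.of_preimage_blowUp {d : ℕ} {t : E d} {N : ℝ} {A : Set (E d)} {l : ℝ}
    {Δ : Set (E d)} (h : ContainsCopy (blowUp t N ⁻¹' A) l Δ) : ContainsCopy A (N * l) Δ := by
  obtain ⟨x, U, hxU⟩ := h
  refine ⟨blowUp t N x, U, ?_⟩
  rintro _ ⟨p, hp, rfl⟩
  have h1 : blowUp t N (x + l • rot U p) ∈ A := hxU ⟨p, hp, rfl⟩
  have h2 : blowUp t N (x + l • rot U p) = blowUp t N x + (N * l) • rot U p := by
    unfold blowUp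
    module
  rwa [h2] at h1

/-- The density of `A` in the cube of side `N` centred at `t`. -/
def density {d : ℕ} (A : Set (E d)) (t : E d) (N : ℝ) : ℝ := volume.real (A ∩ cube t N) / N ^ d

theorem upperBanachDensity_congr {d : ℕ} {A B : Set (E d)} (h : A =ᵐ[volume] B) :
    upperBanachDensity A = upperBanachDensity B := by
  unfold upperBanachDensity
  have h1 : ∀ (t : E d) (N : ℝ), volume (A ∩ cube t N) = volume (B ∩ cube t N) := fun t N =>
    measure_congr (h.inter (ae_eq_refl _))
  simp only [h1]

/-- The two uses of the upper limit δ: at all large scales no cube has density above δ + η, and at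
arbitrarily large scales some cube has density at least δ - η. -/
theorem exists_density {d : ℕ} {A : Set (E d)} (hA : 0 < upperBanachDensity A) :
    ∃ δ : ℝ, 0 < δ ∧ ∀ η : ℝ, 0 < η →
      (∃ M₀ : ℝ, 0 < M₀ ∧ ∀ N, M₀ ≤ N → ∀ t, density A t N ≤ δ + η) ∧
      ∀ N₀ : ℝ, ∃ N, N₀ ≤ N ∧ ∃ t, δ - η ≤ density A t N := by
  set D : ℝ → E d → ℝ≥0∞ := fun N t => volume (A ∩ cube t N) / volume (cube (0 : E d) N) with hD
  have hvol : ∀ (t : E d) N, volume (cube t N) = volume (cube (0 : E d) N) := fun t N => by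
    rw [volume_cube, volume_cube]
  have hD1 : ∀ N t, D N t ≤ 1 := fun N t => by
    refine ENNReal.div_le_of_le_mul ?_
    rw [one_mul, ← hvol t N]
    exact measure_mono inter_subset_right
  have hDd : ∀ N, 0 < N → ∀ t, (D N t).toReal = density A t N := fun N hN t => by
    rw [hD, density, ENNReal.toReal_div, ← measureReal_def, ← measureReal_def,
      volume_real_cube 0 hN.le]
  have hlim : upperBanachDensity A = limsup (fun N => ⨆ t, D N t) atTop := rfl
  have hle1 : upperBanachDensity A ≤ 1 := by
    rw [hlim]
    refine limsup_le_of_le (by isBoundedDefault) (Eventually.of_forall fun N => ?_)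
    exact iSup_le fun t => hD1 N t
  have hfin : upperBanachDensity A ≠ ∞ := (hle1.trans_lt ENNReal.one_lt_top).ne
  set δ := (upperBanachDensity A).toReal with hδ
  have hδpos : 0 < δ := ENNReal.toReal_pos hA.ne' hfin
  have hδE : ENNReal.ofReal δ = upperBanachDensity A := ENNReal.ofReal_toReal hfin
  refine ⟨δ, hδpos, fun η hη => ⟨?_, fun N₀ => ?_⟩⟩
  · have h1 : limsup (fun N => ⨆ t, D N t) atTop < ENNReal.ofReal (δ + η) := by
      rw [← hlim, ← hδE]
      exact (ENNReal.ofReal_lt_ofReal_iff (by positivity)).2 (by linarith)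
    obtain ⟨M, hM⟩ := eventually_atTop.1 (eventually_lt_of_limsup_lt h1)
    refine ⟨max M 1, by positivity, fun N hN t => ?_⟩
    have hN0 : 0 < N := lt_of_lt_of_le one_pos ((le_max_right _ _).trans hN)
    have h2 := (le_iSup (D N) t).trans (hM N ((le_max_left _ _).trans hN)).le
    rw [← hDd N hN0]
    exact ENNReal.toReal_le_of_le_ofReal (by positivity) h2
  · have h1 : ENNReal.ofReal (δ - η) < limsup (fun N => ⨆ t, D N t) atTop := by
      rw [← hlim, ← hδE]
      exact (ENNReal.ofReal_lt_ofReal_iff hδpos).2 (by linarith)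
    obtain ⟨N, hN, hlt⟩ := frequently_atTop.1 (frequently_lt_of_lt_limsup (by isBoundedDefault) h1)
      (max N₀ 1)
    obtain ⟨t, ht⟩ := lt_iSup_iff.1 hlt
    have hN0 : 0 < N := lt_of_lt_of_le one_pos ((le_max_right _ _).trans hN)
    refine ⟨N, (le_max_left _ _).trans hN, t, ?_⟩
    rw [← hDd N hN0]
    exact (ENNReal.ofReal_le_iff_le_toReal ((hD1 N t).trans_lt ENNReal.one_lt_top).ne).1 ht.le

/-- The error in the counting estimate for sets that are `(ε, ε^4 l)`-uniformly distributed with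
`l ≤ ε`. -/
def errorBound (k d : ℕ) (c R ε : ℝ) : ℝ :=
  k * √(ε ^ 2 + d * 2 ^ d * ε ^ 5 + chordConst d * √(d * (ε ^ 4 / 2) / c)) + 2 * d * (ε * R)

theorem exists_errorBound_lt (k d : ℕ) (c R : ℝ) {τ : ℝ} (hτ : 0 < τ) :
    ∃ ε : ℝ, 0 < ε ∧ ε ≤ 1 ∧ errorBound k d c R ε < τ := by
  have hcont : Continuous (errorBound k d c R) := by
    unfold errorBound; fun_prop
  have h0 : errorBound k d c R 0 = 0 := by simp [errorBound]
  have h1 : ∀ᶠ ε in 𝓝[>] (0 : ℝ), errorBound k d c R ε < τ :=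
    (hcont.tendsto 0).eventually_lt_const (by rwa [h0]) |>.filter_mono nhdsWithin_le_nhds
  have h2 : ∀ᶠ ε in 𝓝[>] (0 : ℝ), ε ∈ Ioc (0 : ℝ) 1 := Ioc_mem_nhdsGT one_pos
  obtain ⟨ε, hε1, hε2⟩ := (h1.and h2).exists
  exact ⟨ε, hε2.1, hε2.2, hε1⟩

/-- First ε is fixed so that the counting error is below (δ/2)^{k+1}. For given l, a cube of side N
much larger than l is rescaled to the unit cube; its subcubes of side L there correspond to cubes of
side ε⁴l in the original space. -/
theorem exists_containsCopy_of_upperBanachDensity_pos {k d : ℕ} (hk : 1 ≤ k) (hd : k + 1 ≤ d)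
    {v : Fin k → E d} (hv : LinearIndependent ℝ v) {A : Set (E d)} (hA : MeasurableSet A)
    (hpos : 0 < upperBanachDensity A) :
    ∃ l₀ : ℝ, 0 < l₀ ∧ ∀ l : ℝ, l₀ ≤ l → ContainsCopy A l (simplex v) := by
  obtain ⟨δ, hδ, hdens⟩ := exists_density hpos
  set c := simplexWidth v with hc
  have hcpos : 0 < c := simplexWidth_pos hk hv
  obtain ⟨R, hR⟩ : ∃ R, ∀ j, ‖v j‖ ≤ R :=
    ⟨∑ j, ‖v j‖, fun j => Finset.single_le_sum (fun i _ => norm_nonneg (v i)) (Finset.mem_univ j)⟩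
  have hR0 : 0 ≤ R := (norm_nonneg _).trans (hR ⟨0, hk⟩)
  obtain ⟨ε, hε, hε1, herr⟩ := exists_errorBound_lt k d c R (by positivity : 0 < (δ / 2) ^ (k + 1))
  -- The gap between upper and attained density is at most 2η, and the variance bound doubles it: 4η
  -- ≤ ε²/2. The other term ensures density at least δ/2.
  set η := min (ε ^ 2 / 8) (δ / 2) with hη
  have hηpos : 0 < η := by positivity
  obtain ⟨⟨M₀, hM₀, hup⟩, hlow⟩ := hdens η hηpos
  have hd0 : (0 : ℝ) < d := by exact_mod_cast (by omega : 0 < d)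
  -- The upper density bound is needed already at scale ε⁴l.
  refine ⟨M₀ / ε ^ 4, by positivity, fun l hl => ?_⟩
  have hlpos : 0 < l := lt_of_lt_of_le (by positivity) hl
  have hM : M₀ ≤ ε ^ 4 * l := by
    rw [div_le_iff₀ (by positivity)] at hl
    linarith
  -- The three lower bounds on N give, in order, the upper density bound at scale N, l/N ≤ ε, and a
  -- boundary term of at most ε²/2.
  obtain ⟨N, hN, t, ht⟩ := hlow (max M₀ (max (l / ε) (2 * (d * 2 ^ d) * (ε ^ 4 * l) / ε ^ 2)))
  have hNM : M₀ ≤ N := (le_max_left _ _).trans hN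
  have hNl : l / ε ≤ N := ((le_max_left _ _).trans (le_max_right _ _)).trans hN
  have hNL : 2 * (d * 2 ^ d) * (ε ^ 4 * l) / ε ^ 2 ≤ N :=
    ((le_max_right _ _).trans (le_max_right _ _)).trans hN
  have hN0 : 0 < N := hM₀.trans_le hNM
  set B := blowUp t N ⁻¹' (A ∩ cube t N) with hB
  have hBm : MeasurableSet B := measurable_blowUp t N (hA.inter (measurableSet_cube t N))
  have hBQ : B ⊆ unitCube d := by
    rw [← preimage_blowUp_cube_center t hN0]
    exact preimage_mono inter_subset_right
  have hα : volume.real B = density A t N := volume_real_preimage_blowUp t hN0 _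
  set l' := l / N with hl'
  have hl'pos : 0 < l' := by positivity
  have hl'ε : l' ≤ ε := by
    rw [hl', div_le_iff₀ hN0]
    rw [div_le_iff₀ hε] at hNl
    linarith
  set L := ε ^ 4 * l' with hL
  have hLpos : 0 < L := by positivity
  have hL5 : L ≤ ε ^ 5 := by
    calc L ≤ ε ^ 4 * ε := by rw [hL]; gcongr
      _ = ε ^ 5 := by ring
  have hL1 : L ≤ 1 := hL5.trans (pow_le_one₀ hε.le hε1)
  have hLsmall : d * 2 ^ d * L ≤ ε ^ 2 / 2 := by
    rw [div_le_iff₀ (by positivity)] at hNL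
    have : d * 2 ^ d * L = d * 2 ^ d * (ε ^ 4 * l) / N := by rw [hL, hl']; ring
    rw [this, div_le_iff₀ hN0]
    linarith
  have hαG : volume.real B ≤ δ + η := by rw [hα]; exact hup N hNM t
  have hG : ∀ s : E d, volume.real (B ∩ cube s L) / volume.real (cube (0 : E d) L) ≤ δ + η := by
    intro s
    refine le_trans ?_ (hup (ε ^ 4 * l) hM (blowUp t N s))
    have hLM : L = ε ^ 4 * l / N := by rw [hL, hl']; ring
    rw [volume_real_cube 0 hLpos.le, density]
    have h1 : volume.real (B ∩ cube s L) ≤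
        volume.real (A ∩ cube (blowUp t N s) (ε ^ 4 * l)) / N ^ d := by
      rw [← volume_real_preimage_blowUp t hN0, preimage_inter, preimage_blowUp_cube t s hN0, ← hLM]
      refine measureReal_mono (inter_subset_inter_left _ (preimage_mono inter_subset_left)) ?_
      exact ((measure_mono inter_subset_right).trans_lt (volume_cube_ne_top s L).lt_top).ne
    calc volume.real (B ∩ cube s L) / L ^ d
        ≤ volume.real (A ∩ cube (blowUp t N s) (ε ^ 4 * l)) / N ^ d / L ^ d := by gcongr
      _ = volume.real (A ∩ cube (blowUp t N s) (ε ^ 4 * l)) / (ε ^ 4 * l) ^ d := by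
          rw [div_div, ← mul_pow, hLM, mul_div_cancel₀ _ hN0.ne']
  have hη8 : η ≤ ε ^ 2 / 8 := min_le_left _ _
  have hη2 : η ≤ δ / 2 := min_le_right _ _
  have hu : IsUniformlyDistributed ε L B := by
    refine ⟨hBQ, (integral_sq_density_le hBm hBQ hLpos hL1 hαG hG).trans ?_⟩
    rw [hα]
    linarith
  have hcount := abs_simplexCount_sub_le hk hd hv hR hl'pos hBm hLpos hL1 hu
  have herr2 : k * formBound d c l' ε L + 2 * d * (l' * R) ≤ errorBound k d c R ε := by
    unfold errorBound formBound
    have h1 : d * (L / 2) / (l' * c) = d * (ε ^ 4 / 2) / c := by rw [hL]; field_simp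
    have := chordConst_pos d
    rw [h1]
    gcongr
  have hpow : (δ / 2) ^ (k + 1) ≤ volume.real B ^ (k + 1) := by
    rw [hα]
    gcongr
    linarith
  have hcopy := containsCopy_of_error_lt hd hcount ((herr2.trans_lt herr).trans_le hpow)
  have hfin := (hcopy.of_preimage_blowUp).mono inter_subset_left
  rwa [hl', mul_div_cancel₀ _ hN0.ne'] at hfin

end Simplices

end

/-! ### Passage to null measurable sets -/

theorem mainTheorem3 (k d : ℕ) (hk : 1 ≤ k) (hd : k + 1 ≤ d) :
    (∃ C : ℝ, 0 < C ∧ ∀ R : ℝ, 0 < R → ∃ ε₀ : ℝ, 0 < ε₀ ∧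
      ∀ v : Fin k → Simplices.E d, LinearIndependent ℝ v →
        (∀ j, ‖v j‖ ≤ R) → Simplices.simplexWidth v ≤ 1 →
      ∀ ε l : ℝ, 0 < l → l ≤ ε → ε ≤ ε₀ →
      ∀ A : Set (Simplices.E d), NullMeasurableSet A volume → 0 < volume.real A →
        Simplices.IsUniformlyDistributed ε (ε ^ 4 * l) A →
        |Simplices.simplexCount A v l - volume.real A ^ (k + 1)| ≤
            C * (Simplices.simplexWidth v ^ (-(1 / 6) : ℝ) * ε ^ (2 / 3 : ℝ)) ∧
        (C * (Simplices.simplexWidth v ^ (-(1 / 6) : ℝ) * ε ^ (2 / 3 : ℝ)) <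
            volume.real A ^ (k + 1) →
          Simplices.ContainsCopy A l (Simplices.simplex v))) ∧
    (∀ v : Fin k → Simplices.E d, LinearIndependent ℝ v →
      ∀ A : Set (Simplices.E d), NullMeasurableSet A volume →
        0 < Simplices.upperBanachDensity A →
        ∃ l₀ : ℝ, 0 < l₀ ∧ ∀ l : ℝ, l₀ ≤ l →
          Simplices.ContainsCopy A l (Simplices.simplex v)) := by
  refine ⟨⟨Simplices.countConst k d, ?_, fun R hR => ⟨min 1 (1 / R ^ 3), by positivity, ?_⟩⟩, ?_⟩
  · have := Simplices.chordConst_pos d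
    unfold Simplices.countConst
    positivity
  · intro v hv hvR hc1 ε l hl hle hε A hA _ hu
    -- A measurable subset B of full measure in A stays in the unit cube and is as uniformly
    -- distributed; its count and measure agree with those of A.
    obtain ⟨B, hBA, hBm, hBe⟩ := hA.exists_measurable_subset_ae_eq
    have hεR : ε * R ^ 3 ≤ 1 := by
      have := hε.trans (min_le_right _ _)
      rwa [le_div_iff₀ (by positivity)] at this
    have h := Simplices.abs_simplexCount_sub_le_countConst hk hd hR hv hvR hc1 hl hle
      (hε.trans (min_le_left _ _)) hεR hBm (hu.congr hBA hBe)
    rw [Simplices.simplexCount_congr v l hBe, measureReal_congr hBe] at h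
    exact ⟨h, fun hlt => Simplices.containsCopy_of_error_lt hd h hlt⟩
  · intro v hv A hA hpos
    -- Here B has the same upper Banach density, and copies in the subset B are copies in A.
    obtain ⟨B, hBA, hBm, hBe⟩ := hA.exists_measurable_subset_ae_eq
    rw [← Simplices.upperBanachDensity_congr hBe] at hpos
    obtain ⟨l₀, hl₀, h⟩ := Simplices.exists_containsCopy_of_upperBanachDensity_pos hk hd hv hBm hpos
    exact ⟨l₀, hl₀, fun l hl => (h l hl).mono hBA⟩
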